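/- **Theorem (deterministic quantum simulated cooling).** For every constant $c>0$ there are constants $C,\varepsilon_0>0$, depending only on $c$, such that the following holds for all $n$, all $L\ge 1$ and all $0<\varepsilon<\varepsilon_0$. Let $H_S$ be a Hamiltonian (Hermitian operator) on $n$ qubits and let $|0\rangle,\dots,|L\rangle$ be orthonormal states whose span $\mathbf S_1$ is invariant under $H_S$; let $\mathbf S_2=\mathbf S_1^\perp$, and write $\mathbf S_i$ also for the orthogonal projector (acting trivially on an additional bath qubit where needed). Assume $$\mathbf S_1H_S\mathbf S_1=\sum_{j=0}^L\omega_j|j\rangle\langle j|,\qquad 0=\omega_0<\omega_1<\dots<\omega_L,$$ that every $\omega_j$ is a nondegenerate eigenvalue of $H_S$, that $|0\rangle$ is the ground state of $H_S$ (no eigenvalue of $H_S$ is below $\omega_0=0$), and put $$\Delta=\min\{|E-\omega_i| : 0\le i\le L,\ E\in\mathrm{Spec}(H_S),\ E\ne\omega_i\}>0 .$$ Let $T_S$ be a Hermitian operator on the $n$ qubits with $\mathbf S_1T_S\mathbf S_1=\Omega_0|G\rangle\langle G|$, where $|G\rangle=\sum_{j=0}^Lx_j|j\rangle$ is a normalized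 state with $|x_j|>0$ for all $j$, and let $\hat\delta_1,\dots,\hat\delta_L$ be Hermitian operators on the $n$ qubits and the bath qubit. With $V=T_S\otimes\sigma_x$, $r=\Omega_0/\Delta$ and $\|\cdot\|$ the operator 2-norm, assume for $1\le j\le L$ $$r<\tfrac18,\qquad \frac{\|\mathbf S_1\hat\delta_j\mathbf S_1\|}{\Delta}<r\,\frac{\Omega_0|x_0x_j|}{\Delta},\qquad \frac{\|\mathbf S_1(V+\hat\delta_j)\mathbf S_2\|^2}{\Delta^2}<r\,\frac{\Omega_0|x_0x_j|}{\Delta},\qquad \frac{\|\mathbf S_2(V+\hat\delta_j)\mathbf S_2\|}{\Delta}<\tfrac12 ,$$ and assume $r=c\,\varepsilon L^{-5/2}$. Then there are bath energies $\omega_B^{(j)}\in\mathbb R$ and times $\tau_j>0$ ($1\le j\le L$) such that, with the unitaries $$U_j=\exp\!\left(-i\tau_j\left(H_S+\omega_B^{(j)}|{\uparrow}\rangle\langle{\uparrow}|+T_S\otimes\sigma_x+\hat\delta_j\right)\right),$$ the cooling steps (measure the bath qubit, apply $U_j$ if it is $\downarrow$) $$E_j(\rho)=U_j|{\downarrow}\rangle\langle{\downarrow}|\,\rho\,|{\downarrow}\rangle\langle{\downarrow}|U_j^\dagger+|{\uparrow}\rangle\langle{\uparrow}|\,\rho\,|{\uparrow}\rangle\langle{\uparrow}|$$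 and $\mathbb E=E_1\circ E_2\circ\dots\circ E_L$, one has for every normalized state $|F\rangle\in\mathbf S_1$ $$\Bigl|1-\mathrm{Tr}\bigl[(|0\rangle\langle0|\otimes\mathbf 1)\,\mathbb E(|F{\downarrow}\rangle\langle F{\downarrow}|)\bigr]\Bigr|\le C\varepsilon ,$$ and the total simulation time satisfies $$T=\sum_{j=1}^L\tau_j\le C\,\frac{L^{5/2}}{\varepsilon\,\Delta\,|x_0|}\sum_{j=1}^L\frac1{|x_j|}.$$ -/

import Mathlib

open scoped Kronecker Matrix.Norms.L2Operator

/-- Computational basis labels of `n` qubits. -/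
abbrev Qubits (n : ℕ) : Type := Fin n → Fin 2

/-- State vectors of the system (`n` qubits), with the Euclidean inner product. -/
abbrev SysVec (n : ℕ) : Type := EuclideanSpace ℂ (Qubits n)

/-- Operators on the system. -/
abbrev SysOp (n : ℕ) : Type := Matrix (Qubits n) (Qubits n) ℂ

/-- Operators on the system together with the bath qubit (`n + 1` qubits).  In the bath factor
`0` is the state `↓` and `1` is the state `↑`.  Norms of operators are the operator 2-norm. -/
abbrev JointOp (n : ℕ) : Type := Matrix (Qubits n × Fin 2) (Qubits n × Fin 2) ℂ

/-- The operator `|u⟩⟨v|`. -/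
def ketbra {n : ℕ} (u v : SysVec n) : SysOp n :=
  Matrix.vecMulVec u.ofLp (star v.ofLp)

/-- The bath projector `|↓⟩⟨↓|`. -/
def bathDown : Matrix (Fin 2) (Fin 2) ℂ := !![1, 0; 0, 0]

/-- The bath projector `|↑⟩⟨↑|`. -/
def bathUp : Matrix (Fin 2) (Fin 2) ℂ := !![0, 0; 0, 1]

/-- The Pauli operator `σ_x` on the bath qubit. -/
def sigmaX : Matrix (Fin 2) (Fin 2) ℂ := !![0, 1; 1, 0]

/-- The orthogonal projector onto the span `S₁` of the orthonormal family `|0⟩, …, |L⟩`. -/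
def projS1 {n L : ℕ} (ket : Fin (L + 1) → SysVec n) : SysOp n :=
  ∑ j, ketbra (ket j) (ket j)

/-- The projector onto `S₂`, the orthogonal complement of `S₁`. -/
def projS2 {n L : ℕ} (ket : Fin (L + 1) → SysVec n) : SysOp n :=
  1 - projS1 ket

/-- `H_S` is a Hamiltonian on `n` qubits which leaves `S₁ = span{|0⟩, …, |L⟩}` invariant,
has there the levels `0 = ω₀ < ω₁ < … < ω_L`, each a nondegenerate eigenvalue of `H_S`, with
`|0⟩` the ground state of `H_S`, and `Δ > 0` is the spectral resolution of `S₁`: the least distance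
of a level `ω_i` to another point of the spectrum of `H_S`. -/
structure IsResolvedBand {n L : ℕ} (HS : SysOp n) (ket : Fin (L + 1) → SysVec n)
    (ω : Fin (L + 1) → ℝ) (Δ : ℝ) : Prop where
  isHermitian : HS.IsHermitian
  orthonormal : Orthonormal ℂ ket
  invariant : Commute HS (projS1 ket)
  block : projS1 ket * HS * projS1 ket = ∑ j, (ω j : ℂ) • ketbra (ket j) (ket j)
  zero_level : ω 0 = 0
  strictMono : StrictMono ω
  nondegenerate : ∀ j,
    Module.finrank ℂ (Module.End.eigenspace (Matrix.toLin' HS) (ω j : ℂ)) = 1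
  ground : ∀ E ∈ spectrum ℝ HS, ω 0 ≤ E
  gap : IsLeast {d : ℝ | ∃ i, ∃ E ∈ spectrum ℝ HS, E ≠ ω i ∧ d = |E - ω i|} Δ
  gap_pos : 0 < Δ

/-- The state `|G⟩ = ∑ⱼ xⱼ |j⟩`. -/
noncomputable def stateG {n L : ℕ} (ket : Fin (L + 1) → SysVec n) (x : Fin (L + 1) → ℂ) :
    SysVec n :=
  ∑ j, x j • ket j

/-- `T_S` is a Hermitian operator with `S₁ T_S S₁ = Ω₀ |G⟩⟨G|`, where `|G⟩ = ∑ⱼ xⱼ |j⟩` is a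
normalized state all of whose coefficients are nonzero. -/
structure IsCoupling {n L : ℕ} (ket : Fin (L + 1) → SysVec n) (x : Fin (L + 1) → ℂ)
    (Ω₀ : ℝ) (TS : SysOp n) : Prop where
  isHermitian : TS.IsHermitian
  normalized : ‖stateG ket x‖ = 1
  coeff_ne : ∀ j, 0 < ‖x j‖
  block : projS1 ket * TS * projS1 ket = (Ω₀ : ℂ) • ketbra (stateG ket x) (stateG ket x)

/-- The bounds on the interaction strength and on the Hermitian error term `δ` of one cooling step,
where `x0` and `xj` are the coefficients of `|G⟩` at the ground state and at the level that is
cooled.  The projectors of `S₁`, `S₂` act trivially on the bath. -/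
structure ErrorBound {n L : ℕ} (ket : Fin (L + 1) → SysVec n) (x0 xj : ℂ) (Δ Ω₀ : ℝ)
    (TS : SysOp n) (δ : JointOp n) : Prop where
  isHermitian : δ.IsHermitian
  ratio : Ω₀ / Δ < 1 / 8
  block11 : ‖(projS1 ket ⊗ₖ (1 : Matrix (Fin 2) (Fin 2) ℂ)) * δ *
      (projS1 ket ⊗ₖ (1 : Matrix (Fin 2) (Fin 2) ℂ))‖ / Δ
      < (Ω₀ / Δ) * (Ω₀ * ‖x0 * xj‖ / Δ)
  block12 : ‖(projS1 ket ⊗ₖ (1 : Matrix (Fin 2) (Fin 2) ℂ)) * (TS ⊗ₖ sigmaX + δ) *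
      (projS2 ket ⊗ₖ (1 : Matrix (Fin 2) (Fin 2) ℂ))‖ ^ 2 / Δ ^ 2
      < (Ω₀ / Δ) * (Ω₀ * ‖x0 * xj‖ / Δ)
  block22 : ‖(projS2 ket ⊗ₖ (1 : Matrix (Fin 2) (Fin 2) ℂ)) * (TS ⊗ₖ sigmaX + δ) *
      (projS2 ket ⊗ₖ (1 : Matrix (Fin 2) (Fin 2) ℂ))‖ / Δ < 1 / 2

/-- The Hamiltonian `H_S + ω_B |↑⟩⟨↑| + T_S ⊗ σ_x + δ`. -/
noncomputable def stepHamiltonian {n : ℕ} (HS TS : SysOp n) (ωB : ℝ) (δ : JointOp n) :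
    JointOp n :=
  HS ⊗ₖ (1 : Matrix (Fin 2) (Fin 2) ℂ) + (ωB : ℂ) • ((1 : SysOp n) ⊗ₖ bathUp)
    + TS ⊗ₖ sigmaX + δ

/-- The evolution `exp (-i τ H)`. -/
noncomputable def evolution {n : ℕ} (τ : ℝ) (H : JointOp n) : JointOp n :=
  NormedSpace.exp ((-Complex.I * (τ : ℂ)) • H)

/-- One cooling step: measure the bath qubit, and apply `U` if the outcome is `↓`. -/
noncomputable def coolingStep {n : ℕ} (U ρ : JointOp n) : JointOp n :=
  U * ((1 : SysOp n) ⊗ₖ bathDown) * ρ * ((1 : SysOp n) ⊗ₖ bathDown) * U.conjTranspose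
    + ((1 : SysOp n) ⊗ₖ bathUp) * ρ * ((1 : SysOp n) ⊗ₖ bathUp)

/-- The complete map `E₁ ∘ E₂ ∘ … ∘ E_L` (so `E_L` acts first), where `E_{k+1}` is the cooling step
with the unitary `U k`, for `k = 0, …, L - 1`. -/
noncomputable def coolingMap {n : ℕ} : {L : ℕ} → (Fin L → JointOp n) → JointOp n → JointOp n
  | 0, _, ρ => ρ
  | L + 1, U, ρ => coolingMap (fun k : Fin L => U k.castSucc) (coolingStep (U (Fin.last L)) ρ)

/-! ### Exact reduction to a few near-degenerate levels with self-consistent level shifts. -/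

section Perturbation

variable {E : Type*} [NormedAddCommGroup E] [InnerProductSpace ℂ E] [FiniteDimensional ℂ E]

/-! Each cooling step is a Rabi transfer. When the bath energy is close to `ω j`, the states `|j↓⟩`
and `|0↑⟩` are nearly degenerate, the interaction couples them with strength about `Ω₀ |x₀ xⱼ|`, and
every other unperturbed level is at least `Δ` away.

The coupling may be far smaller than the available bounds on the level shifts, so resonance has to
be tuned exactly. `exists_dressed_levels` does this by a fixed-point argument: it yields shifts and
corrections `z`, `z'` of size `O(r)` such that the shifted Hamiltonian sends `p + z` to a multiple
of `q`, and `q + z'` to a multiple of `p`. The difference of the two shifts is absorbed into the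
bath energy. The explicit Rabi solution on these dressed vectors then has a defect of order
(coupling) × `O(r)` and runs for a time of order 1/(coupling), so the transfer error is `O(r)`
however small the coupling is (`norm_exp_apply_sub_le_of_resonant`). The time bound needs the
effective coupling to stay above a constant times `Ω₀ |x₀ xⱼ|`; this is
`effective_coupling_lower_bound`, where the rank-one form of the coupling supplies both small
factors in the higher-order terms.

During step `j` a lower level `|i↓⟩`, `i < j`, is isolated: its `↑` partners have energy at least `ω
j > ω i`, because `|0⟩` is the ground state. It therefore only acquires a phase, up to `O(r)`
(`lower_level_evolution`).

The highest level is cooled first. After each step the state is, up to error, a combination of lower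
levels with `↓` and of `|0↑⟩`, which is never touched again. The square root of the failure
probability is subadditive, so the errors add as amplitudes: each of the `L` steps costs `O(r)`
times the `ℓ¹` norm of the amplitudes, at most `√(L+1)`. The failure probability is thus `O(r² L²
(L+1))`. -/

/-- An operator whose compression to a subspace is bounded below is solvable on that subspace. -/
theorem exists_compression_eq (F : Submodule ℂ E) (A : E →L[ℂ] E) {κ : ℝ} (hκ : 0 < κ)
    (hlow : ∀ v ∈ F, κ * ‖v‖ ≤ ‖F.starProjection (A v)‖) (w : E) :
    ∃ z ∈ F, F.starProjection (A z) = F.starProjection w := by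
  let T : F →ₗ[ℂ] F :=
    (F.orthogonalProjectionOnto : E →ₗ[ℂ] F) ∘ₗ (A : E →ₗ[ℂ] E) ∘ₗ F.subtype
  have hT : Function.Injective T := by
    rw [injective_iff_map_eq_zero]
    intro v hv
    have h1 := hlow v v.2
    have h2 : F.starProjection (A v) = 0 := by
      rw [Submodule.starProjection_apply]
      exact congrArg Subtype.val hv
    rw [h2, norm_zero] at h1
    have h3 : ‖(v : E)‖ = 0 := le_antisymm (by nlinarith [norm_nonneg (v : E)]) (norm_nonneg _)
    exact Subtype.ext (norm_eq_zero.1 h3)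
  obtain ⟨z, hz⟩ := LinearMap.injective_iff_surjective.1 hT (F.orthogonalProjectionOnto w)
  refine ⟨z, z.2, ?_⟩
  rw [Submodule.starProjection_apply, Submodule.starProjection_apply]
  exact congrArg Subtype.val hz

/-- Self-consistent form of the Feshbach reduction: near-degenerate levels `p i` of a Hermitian
operator `M` are dressed by vectors `z i ∈ F`, with level shifts `e i`, so that
`M - ∑ e l • n l` maps `p i + z i` to a vector orthogonal to `p i` and to `F`. -/
theorem exists_dressed_levels {ι : Type*} [Fintype ι] [DecidableEq ι] (F : Submodule ℂ E)
    (p : ι → E) (hp : ∀ i, ‖p i‖ = 1) (hpF : ∀ i, ∀ v ∈ F, inner ℂ v (p i) = 0)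
    (M : E →L[ℂ] E) (hM : ∀ v w, inner ℂ (M v) w = inner ℂ v (M w))
    (n : ι → E →L[ℂ] E) (hn : ∀ i v w, inner ℂ (n i v) w = inner ℂ v (n i w))
    (hnp : ∀ i l, n i (p l) = if i = l then p l else 0)
    (hN : ∀ (e : ι → ℝ) (v : E), ‖∑ i, (e i : ℂ) • n i v‖ ≤ ‖e‖ * ‖v‖)
    {κ s : ℝ} (hκ : 0 < κ) (hs : s ≤ κ / 4) (hMp : ∀ i, ‖M (p i)‖ ≤ s)
    (hlow : ∀ v ∈ F, κ * ‖v‖ ≤ ‖F.starProjection (M v)‖) :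
    ∃ (e : ι → ℝ) (z : ι → E), (∀ i, |e i| ≤ 2 * s) ∧ (∀ i, z i ∈ F) ∧
      (∀ i, ‖z i‖ ≤ 2 * s / κ) ∧
      (∀ i, ∀ v ∈ F, inner ℂ v (M (p i + z i) - ∑ l, (e l : ℂ) • n l (p i + z i)) = 0) ∧
      (∀ i, inner ℂ (p i) (M (p i + z i) - ∑ l, (e l : ℂ) • n l (p i + z i)) = 0) := by
  rcases isEmpty_or_nonempty ι with hι | ⟨⟨i₀⟩⟩
  · exact ⟨fun _ => 0, fun _ => 0, fun i => hι.elim i, fun i => hι.elim i, fun i => hι.elim i,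
      fun i => hι.elim i, fun i => hι.elim i⟩
  have hs0 : 0 ≤ s := (norm_nonneg _).trans (hMp i₀)
  let N : (ι → ℝ) → E →L[ℂ] E := fun e => ∑ i, (e i : ℂ) • n i
  have hNap : ∀ e v, N e v = ∑ i, (e i : ℂ) • n i v := fun e v => by
    simp [N]
  have hNn : ∀ e v, ‖N e v‖ ≤ ‖e‖ * ‖v‖ := fun e v => by rw [hNap]; exact hN e v
  have hNsub : ∀ e e' v, N e v - N e' v = N (e - e') v := fun e e' v => by
    simp only [hNap, Pi.sub_apply, Complex.ofReal_sub, sub_smul, Finset.sum_sub_distrib]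
  have hNsym : ∀ e v w, inner ℂ (N e v) w = inner ℂ v (N e w) := fun e v w => by
    simp only [hNap, sum_inner, inner_sum, inner_smul_left, inner_smul_right, hn,
      Complex.conj_ofReal]
  have hNp : ∀ e i, N e (p i) = (e i : ℂ) • p i := fun e i => by
    simp [hNap, hnp]
  let P := F.starProjection
  have hPn : ∀ v, ‖P v‖ ≤ ‖v‖ := fun v => F.norm_starProjection_apply_le v
  have hPin : ∀ v ∈ F, ∀ w, inner ℂ v (P w) = inner ℂ v w := fun v hv w => by
    have h := Submodule.inner_starProjection_left_eq_right F v w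
    rw [← h, Submodule.starProjection_eq_self_iff.2 hv]
  have hPp : ∀ i, P (p i) = 0 := fun i =>
    (Submodule.starProjection_apply_eq_zero_iff F).2 ((Submodule.mem_orthogonal F _).2 (hpF i))
  have hlow' : ∀ e : ι → ℝ, ‖e‖ ≤ κ / 2 → ∀ v ∈ F, κ / 2 * ‖v‖ ≤ ‖P ((M - N e) v)‖ := by
    intro e he v hv
    have h1 := hlow v hv
    have h2 : ‖P (N e v)‖ ≤ κ / 2 * ‖v‖ := (hPn _).trans ((hNn e v).trans (by gcongr))
    have h3 : P ((M - N e) v) = P (M v) - P (N e v) := by simp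
    have h4 := norm_sub_norm_le (P (M v)) (P (N e v))
    rw [h3]
    have h5 : κ * ‖v‖ ≤ ‖P (M v)‖ := h1
    linarith
  -- The default `0` for large `e` only serves to make `z` a total function; `z` is evaluated below
  -- only where `‖e‖ ≤ κ / 2`.
  have hex : ∀ e : ι → ℝ, ∀ i, ∃ z ∈ F, ‖e‖ ≤ κ / 2 → P ((M - N e) z) = P (-(M (p i))) := by
    intro e i
    by_cases he : ‖e‖ ≤ κ / 2
    · obtain ⟨z, hz, hz'⟩ := exists_compression_eq F (M - N e) (half_pos hκ) (hlow' e he)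
        (-(M (p i)))
      exact ⟨z, hz, fun _ => hz'⟩
    · exact ⟨0, F.zero_mem, fun h => absurd h he⟩
  choose z hzF hz using hex
  have hzn : ∀ e : ι → ℝ, ‖e‖ ≤ κ / 2 → ∀ i, ‖z e i‖ ≤ 2 * s / κ := by
    intro e he i
    have h1 := hlow' e he _ (hzF e i)
    rw [hz e i he] at h1
    have h2 : ‖P (-(M (p i)))‖ ≤ s := (hPn _).trans (by rw [norm_neg]; exact hMp i)
    rw [le_div_iff₀ hκ]
    nlinarith
  have hzlip : ∀ e e' : ι → ℝ, ‖e‖ ≤ κ / 2 → ‖e'‖ ≤ κ / 2 → ∀ i,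
      κ / 2 * ‖z e i - z e' i‖ ≤ ‖e - e'‖ * (2 * s / κ) := by
    intro e e' he he' i
    have h1 := hlow' e he _ (F.sub_mem (hzF e i) (hzF e' i))
    have h2 : P ((M - N e) (z e i - z e' i)) = P (N (e - e') (z e' i)) := by
      have h3 : (M - N e) (z e i - z e' i)
          = (M - N e) (z e i) - ((M - N e') (z e' i) - N (e - e') (z e' i)) := by
        rw [← hNsub]; simp only [_root_.sub_apply, map_sub]; abel
      rw [h3, map_sub, map_sub, hz e i he, hz e' i he']; abel
    rw [h2] at h1
    refine h1.trans ((hPn _).trans ((hNn _ _).trans ?_))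
    gcongr
    exact hzn e' he' i
  -- Retraction onto the cube where the compression of `M - N e` stays invertible. It makes the map
  -- `Φ` total; its fixed point turns out to lie inside the cube, where the retraction is the
  -- identity.
  let clamp : (ι → ℝ) → (ι → ℝ) := fun e i => max (-(κ / 2)) (min (κ / 2) (e i))
  have hclamp_le : ∀ e, ‖clamp e‖ ≤ κ / 2 := fun e => by
    rw [pi_norm_le_iff_of_nonneg (by positivity)]
    intro i
    rw [Real.norm_eq_abs, abs_le]
    exact ⟨le_max_left _ _, max_le (by linarith) (min_le_left _ _)⟩
  have hclamp_lip : ∀ e e', ‖clamp e - clamp e'‖ ≤ ‖e - e'‖ := fun e e' => by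
    rw [pi_norm_le_iff_of_nonneg (norm_nonneg _)]
    intro i
    have h1 := norm_le_pi_norm (e - e') i
    rw [Pi.sub_apply, Real.norm_eq_abs] at h1 ⊢
    have h2 : |min (κ / 2) (e i) - min (κ / 2) (e' i)| ≤ |e i - e' i| := by
      simpa using abs_min_sub_min_le_max (κ / 2) (e i) (κ / 2) (e' i)
    have h3 := abs_max_sub_max_le_abs (min (κ / 2) (e i)) (min (κ / 2) (e' i)) (-(κ / 2))
    simp only [max_comm _ (-(κ / 2))] at h3
    exact h3.trans (h2.trans h1)
  have hclamp_id : ∀ e : ι → ℝ, ‖e‖ ≤ κ / 2 → clamp e = e := fun e he => by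
    funext i
    have h1 := (norm_le_pi_norm e i).trans he
    rw [Real.norm_eq_abs, abs_le] at h1
    simp only [clamp]
    rw [min_eq_right h1.2, max_eq_right h1.1]
  -- A fixed point of `Φ` is a set of shifts for which the diagonal element of the residual
  -- vanishes: the first-order shift plus the higher-order shift through `F`.
  let Φ : (ι → ℝ) → (ι → ℝ) := fun e i =>
    (inner ℂ (p i) (M (p i))).re + (inner ℂ (M (p i)) (z (clamp e) i)).re
  have hinner : ∀ a b : E, |(inner ℂ a b).re| ≤ ‖a‖ * ‖b‖ := fun a b =>
    (Complex.abs_re_le_norm _).trans (norm_inner_le_norm a b)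
  have hq : s * (2 / κ * (2 * s / κ)) ≤ 1 / 4 := by
    have h1 : s / κ ≤ 1 / 4 := by rw [div_le_iff₀ hκ]; linarith
    have h2 : 0 ≤ s / κ := by positivity
    calc s * (2 / κ * (2 * s / κ)) = 4 * (s / κ) ^ 2 := by ring
      _ ≤ 4 * (1 / 4) ^ 2 := by gcongr
      _ = 1 / 4 := by norm_num
  have hΦ : ContractingWith (1 / 4 : NNReal) Φ := by
    refine ⟨by rw [← NNReal.coe_lt_coe]; norm_num, LipschitzWith.of_dist_le_mul fun e e' => ?_⟩
    rw [dist_eq_norm, dist_eq_norm, pi_norm_le_iff_of_nonneg (by positivity)]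
    intro i
    have h1 : (Φ e - Φ e') i = (inner ℂ (M (p i)) (z (clamp e) i - z (clamp e') i)).re := by
      simp [Φ]
    rw [h1, Real.norm_eq_abs]
    have h2 := hzlip (clamp e) (clamp e') (hclamp_le e) (hclamp_le e') i
    have h3 : ‖z (clamp e) i - z (clamp e') i‖ ≤ 2 / κ * (2 * s / κ) * ‖e - e'‖ := by
      have h4 : ‖clamp e - clamp e'‖ * (2 * s / κ) ≤ ‖e - e'‖ * (2 * s / κ) := by
        gcongr; exact hclamp_lip e e'
      have h5 : ‖z (clamp e) i - z (clamp e') i‖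
          = 2 / κ * (κ / 2 * ‖z (clamp e) i - z (clamp e') i‖) := by field_simp
      rw [h5, mul_assoc]
      refine mul_le_mul_of_nonneg_left ?_ (by positivity)
      linarith
    calc _ ≤ ‖M (p i)‖ * ‖z (clamp e) i - z (clamp e') i‖ := hinner _ _
      _ ≤ s * (2 / κ * (2 * s / κ) * ‖e - e'‖) := by gcongr; exact hMp i
      _ = s * (2 / κ * (2 * s / κ)) * ‖e - e'‖ := by ring
      _ ≤ 1 / 4 * ‖e - e'‖ := by gcongr
      _ = _ := by norm_num
  obtain ⟨e, he⟩ : ∃ e, Φ e = e := ⟨_, hΦ.fixedPoint_isFixedPt⟩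
  have hebd : ∀ i, |e i| ≤ 2 * s := by
    intro i
    have h1 : e i = (inner ℂ (p i) (M (p i))).re + (inner ℂ (M (p i)) (z (clamp e) i)).re :=
      (congrFun he i).symm
    have h2 := hinner (p i) (M (p i))
    have h3 := hinner (M (p i)) (z (clamp e) i)
    have h4 := hzn _ (hclamp_le e) i
    rw [hp i, one_mul] at h2
    have h5 : ‖M (p i)‖ * ‖z (clamp e) i‖ ≤ s * 1 := by
      gcongr
      · exact hMp i
      · refine h4.trans ?_
        rw [div_le_one hκ]; linarith
    rw [h1]
    have h6 := hMp i
    exact (abs_add_le _ _).trans (by linarith)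
  have hen : ‖e‖ ≤ κ / 2 := by
    rw [pi_norm_le_iff_of_nonneg (by positivity)]
    intro i
    rw [Real.norm_eq_abs]
    linarith [hebd i]
  have hce := hclamp_id e hen
  have hres : ∀ i, ∀ v ∈ F, inner ℂ v ((M - N e) (p i + z e i)) = 0 := by
    intro i v hv
    have h1 : P ((M - N e) (p i + z e i)) = 0 := by
      rw [map_add, map_add, hz e i hen, _root_.sub_apply, hNp, map_sub, map_smul,
        hPp, map_neg]
      simp
    rw [← hPin v hv, h1, inner_zero_right]
  refine ⟨e, z e, hebd, hzF e, hzn e hen, fun i v hv => ?_, fun i => ?_⟩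
  · rw [← hNap, ← _root_.sub_apply]
    exact hres i v hv
  rw [← hNap, ← _root_.sub_apply]
  have hreal1 : inner ℂ (p i) (M (p i)) = ((inner ℂ (p i) (M (p i))).re : ℂ) := by
    refine (Complex.conj_eq_iff_re.1 ?_).symm
    rw [inner_conj_symm, hM]
  -- The shifts are real while `Φ` kept only real parts. Nothing is lost: by the equation for `z`,
  -- this product is minus a diagonal element of the symmetric operator `M - N e`.
  have hself : inner ℂ (M (p i)) (z e i) = - inner ℂ ((M - N e) (z e i)) (z e i) := by
    have h1 := hres i (z e i) (hzF e i)
    rw [map_add, inner_add_right, _root_.sub_apply, hNp, inner_sub_right,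
      inner_smul_right, hpF i _ (hzF e i), mul_zero, sub_zero] at h1
    have h2 := congrArg (starRingEnd ℂ) h1
    rw [map_add, inner_conj_symm, inner_conj_symm, map_zero] at h2
    exact eq_neg_of_add_eq_zero_left h2
  have hreal2 : inner ℂ (M (p i)) (z e i) = ((inner ℂ (M (p i)) (z e i)).re : ℂ) := by
    refine (Complex.conj_eq_iff_re.1 ?_).symm
    rw [hself, map_neg, inner_conj_symm]
    simp only [_root_.sub_apply, inner_sub_left, inner_sub_right, hM, hNsym]
  have hei : ((e i : ℝ) : ℂ) = inner ℂ (p i) (M (p i)) + inner ℂ (M (p i)) (z e i) := by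
    have h1 := congrFun he i
    simp only [Φ, hce] at h1
    rw [hreal1, hreal2, ← Complex.ofReal_add, h1]
  have hzp : inner ℂ (p i) (z e i) = 0 := by
    rw [← inner_conj_symm, hpF i _ (hzF e i), map_zero]
  rw [map_add, inner_add_right, _root_.sub_apply, _root_.sub_apply,
    hNp, inner_sub_right, inner_sub_right, inner_smul_right, ← hM (p i) (z e i),
    ← hNsym e (p i) (z e i), hNp, inner_smul_left, hzp, hei,
    inner_self_eq_norm_sq_to_K, hp i]
  simp

end Perturbation

/-! ### Unitary evolution, Duhamel's estimate and Rabi oscillation. -/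

section Evolution

variable {E : Type*} [NormedAddCommGroup E] [InnerProductSpace ℂ E] [CompleteSpace E]

theorem exp_mem_unitary_of_symmetric (H : E →L[ℂ] E)
    (hH : ∀ v w, inner ℂ (H v) w = inner ℂ v (H w)) (τ : ℝ) :
    NormedSpace.exp ((-Complex.I * (τ : ℂ)) • H) ∈ unitary (E →L[ℂ] E) := by
  let : NormedAlgebra ℚ (E →L[ℂ] E) := NormedAlgebra.restrictScalars ℚ ℂ (E →L[ℂ] E)
  have hsa : star H = H :=
    (ContinuousLinearMap.isSelfAdjoint_iff_isSymmetric (A := H)).2 fun v w => hH v w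
  refine NormedSpace.exp_mem_unitary_of_mem_skewAdjoint ?_
  rw [skewAdjoint.mem_iff, star_smul, hsa]
  simp

theorem norm_exp_apply_eq (H : E →L[ℂ] E) (hH : ∀ v w, inner ℂ (H v) w = inner ℂ v (H w))
    (τ : ℝ) (v : E) : ‖NormedSpace.exp ((-Complex.I * (τ : ℂ)) • H) v‖ = ‖v‖ :=
  ContinuousLinearMap.norm_map_of_mem_unitary (exp_mem_unitary_of_symmetric H hH τ) v

/-- Duhamel estimate: an approximate solution of the Schrödinger equation stays close to the
evolution of its initial value. -/
theorem norm_exp_apply_sub_le (H : E →L[ℂ] E) (hH : ∀ v w, inner ℂ (H v) w = inner ℂ v (H w))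
    (φ φ' : ℝ → E) (hφ : ∀ t, HasDerivAt φ (φ' t) t) {B τ : ℝ} (hτ : 0 ≤ τ)
    (hB : ∀ t, ‖φ' t + Complex.I • H (φ t)‖ ≤ B) :
    ‖NormedSpace.exp ((-Complex.I * (τ : ℂ)) • H) (φ 0) - φ τ‖ ≤ B * τ := by
  let : NormedAlgebra ℚ (E →L[ℂ] E) := NormedAlgebra.restrictScalars ℚ ℂ (E →L[ℂ] E)
  let A : ℝ → E →L[ℂ] E := fun t => NormedSpace.exp ((t : ℂ) • (Complex.I • H))
  have hexp : ∀ t : ℝ, NormedSpace.exp ((-Complex.I * (t : ℂ)) • H) = A (-t) := fun t => by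
    simp only [A, smul_smul]
    congr 2; push_cast; ring
  have hiso : ∀ (t : ℝ) (v : E), ‖A t v‖ = ‖v‖ := fun t v => by
    have h := norm_exp_apply_eq H hH (-t) v
    rwa [hexp, neg_neg] at h
  have hA : ∀ t : ℝ, HasDerivAt A (A t * (Complex.I • H)) t := fun t => by
    have h := (hasDerivAt_exp_smul_const (𝕂 := ℂ) (Complex.I • H) (t : ℂ)).scomp t
      (Complex.ofRealCLM.hasDerivAt (x := t))
    rw [Complex.ofRealCLM_apply, Complex.ofReal_one, one_smul] at h
    exact h
  -- Interaction picture: undoing the evolution leaves only the defect of `φ` in the derivative, and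
  -- `A t` is isometric.
  have hg : ∀ t : ℝ, HasDerivAt (fun t : ℝ => A t (φ t))
      (A t (φ' t + Complex.I • H (φ t))) t := fun t => by
    have h2 : HasDerivAt (fun t : ℝ => (A t).restrictScalars ℝ)
        ((A t * (Complex.I • H)).restrictScalars ℝ) t :=
      (ContinuousLinearMap.restrictScalarsL ℂ E E ℝ ℝ).hasFDerivAt.comp_hasDerivAt t (hA t)
    have h3 := h2.clm_apply (hφ t)
    refine h3.congr_deriv ?_
    rw [map_add, add_comm]
    rfl
  have hle := norm_image_sub_le_of_norm_deriv_le_segment' (a := 0) (b := τ) (C := B)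
    (fun t _ => (hg t).hasDerivWithinAt) (fun t _ => (hiso t _).trans_le (hB t)) τ
    (Set.right_mem_Icc.2 hτ)
  have hA0 : A 0 (φ 0) = φ 0 := by
    simp only [A, Complex.ofReal_zero, zero_smul, NormedSpace.exp_zero]
    rfl
  have hinv : A (-τ) (A τ (φ τ)) = φ τ := by
    have h1 : A (-τ) * A τ = 1 := by
      simp only [A, Complex.ofReal_neg, neg_smul]
      rw [← NormedSpace.exp_add_of_commute (Commute.refl _).neg_left]
      simp
    exact congrArg (fun A : E →L[ℂ] E => A (φ τ)) h1
  rw [hA0, sub_zero] at hle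
  rw [hexp]
  have h1 : A (-τ) (φ 0) - φ τ = A (-τ) (φ 0 - A τ (φ τ)) := by rw [map_sub, hinv]
  rw [h1, hiso, norm_sub_rev]
  exact hle

/-- An eigenvector evolves by a phase. -/
theorem exp_apply_eigenvector (H : E →L[ℂ] E) (hH : ∀ v w, inner ℂ (H v) w = inner ℂ v (H w))
    {y : E} {lam : ℝ} (hy : H y = (lam : ℂ) • y) {τ : ℝ} (hτ : 0 ≤ τ) :
    NormedSpace.exp ((-Complex.I * (τ : ℂ)) • H) y
      = Complex.exp (-Complex.I * lam * τ) • y := by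
  have h1 : ∀ t : ℝ, HasDerivAt (fun t : ℝ => Complex.exp (-Complex.I * lam * t) • y)
      ((Complex.exp (-Complex.I * lam * t) * (-Complex.I * lam)) • y) t := fun t => by
    have h := ((Complex.ofRealCLM.hasDerivAt (x := t)).const_mul (-Complex.I * lam)).cexp
    simpa using h.smul_const y
  have h2 := norm_exp_apply_sub_le H hH _ _ h1 (B := 0) hτ fun t => by
    rw [map_smul, hy, smul_smul, smul_smul, ← add_smul]
    rw [norm_le_zero_iff]
    convert zero_smul ℂ y
    ring
  rw [zero_mul, norm_le_zero_iff, sub_eq_zero] at h2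
  simpa using h2

/-- Rabi transfer between two dressed levels `y`, `y'` with the same energy, close to `p`, `q`. -/
theorem norm_exp_apply_sub_le_of_resonant (H : E →L[ℂ] E)
    (hH : ∀ v w, inner ℂ (H v) w = inner ℂ v (H w)) {p q z z' : E} {E₀ : ℝ} {b : ℂ} (hb : b ≠ 0)
    (hy : H (p + z) = (E₀ : ℂ) • (p + z) + (starRingEnd ℂ b) • q)
    (hy' : H (q + z') = (E₀ : ℂ) • (q + z') + b • p) :
    ∃ c : ℂ, ‖c‖ = 1 ∧
      ‖NormedSpace.exp ((-Complex.I * ((Real.pi / (2 * ‖b‖) : ℝ) : ℂ)) • H) p - c • q‖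
        ≤ 3 * (‖z‖ + ‖z'‖) := by
  have hb0 : 0 < ‖b‖ := norm_pos_iff.2 hb
  set β := ‖b‖ with hβ
  have hβc : (β : ℂ) ≠ 0 := Complex.ofReal_ne_zero.2 hb0.ne'
  set b' := starRingEnd ℂ b with hb'
  have hbb : b' * b = (β : ℂ) * β := by
    rw [mul_comm, Complex.mul_conj, Complex.normSq_eq_norm_sq]; push_cast; ring
  have hb'n : ‖b'‖ = β := by rw [hb', RCLike.norm_conj]
  set τ : ℝ := Real.pi / (2 * β) with hτ
  have hτ0 : 0 ≤ τ := by positivity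
  let f : ℝ → ℂ := fun t => Complex.exp (-Complex.I * E₀ * t)
  -- Solution of the ideal two-level problem with Rabi frequency `β = ‖b‖`; at `τ = π / (2β)` the
  -- cosine vanishes and the transfer is complete.
  let a₁ : ℝ → ℂ := fun t => f t * Complex.cos (β * t)
  let a₂ : ℝ → ℂ := fun t => f t * (-Complex.I * (b' / β) * Complex.sin (β * t))
  have hofR : ∀ t : ℝ, HasDerivAt (fun t : ℝ => (t : ℂ)) 1 t := fun t =>
    Complex.ofRealCLM.hasDerivAt (x := t)
  have hf : ∀ t, HasDerivAt f (f t * (-Complex.I * E₀)) t := fun t => by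
    have h := ((hofR t).const_mul (-Complex.I * E₀)).cexp
    rwa [mul_one] at h
  have hcos : ∀ t : ℝ, HasDerivAt (fun t : ℝ => Complex.cos (β * t))
      (-Complex.sin (β * t) * β) t := fun t => by
    have h := (Complex.hasDerivAt_cos _).comp t ((hofR t).const_mul (β : ℂ))
    rwa [mul_one] at h
  have hsin : ∀ t : ℝ, HasDerivAt (fun t : ℝ => Complex.sin (β * t))
      (Complex.cos (β * t) * β) t := fun t => by
    have h := (Complex.hasDerivAt_sin _).comp t ((hofR t).const_mul (β : ℂ))
    rwa [mul_one] at h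
  have hφ : ∀ t, HasDerivAt (fun t => a₁ t • (p + z) + a₂ t • (q + z'))
      ((f t * (-Complex.I * E₀) * Complex.cos (β * t) + f t * (-Complex.sin (β * t) * β)) • (p + z)
        + (f t * (-Complex.I * E₀) * (-Complex.I * (b' / β) * Complex.sin (β * t))
          + f t * (-Complex.I * (b' / β) * (Complex.cos (β * t) * β))) • (q + z')) t := fun t =>
    (((hf t).mul (hcos t)).smul_const _).add
      (((hf t).mul ((hsin t).const_mul _)).smul_const _)
  have hfn : ∀ t, ‖f t‖ = 1 := fun t => by
    have : -Complex.I * E₀ * t = ((-E₀ * t : ℝ) : ℂ) * Complex.I := by push_cast; ring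
    simp only [f]
    rw [this, Complex.norm_exp_ofReal_mul_I]
  have hcn : ∀ t : ℝ, ‖Complex.cos (β * t)‖ ≤ 1 := fun t => by
    rw [← Complex.ofReal_mul, ← Complex.ofReal_cos, Complex.norm_real]
    exact Real.abs_cos_le_one _
  have hsn : ∀ t : ℝ, ‖Complex.sin (β * t)‖ ≤ 1 := fun t => by
    rw [← Complex.ofReal_mul, ← Complex.ofReal_sin, Complex.norm_real]
    exact Real.abs_sin_le_one _
  have hmain := norm_exp_apply_sub_le H hH _ _ hφ (B := β * (‖z‖ + ‖z'‖)) hτ0 fun t => by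
    -- The dressed vectors are mapped to the bare `q` and `p`, so the only defect is the coupling
    -- times `z`, `z'`.
    have key : (f t * (-Complex.I * E₀) * Complex.cos (β * t)
          + f t * (-Complex.sin (β * t) * β)) • (p + z)
        + (f t * (-Complex.I * E₀) * (-Complex.I * (b' / β) * Complex.sin (β * t))
          + f t * (-Complex.I * (b' / β) * (Complex.cos (β * t) * β))) • (q + z')
        + Complex.I • H (a₁ t • (p + z) + a₂ t • (q + z'))
        = (-(f t * Complex.sin (β * t) * β)) • z
          + (-(f t * Complex.I * b' * Complex.cos (β * t))) • z' := by
      simp only [map_add, map_smul] at hy hy' ⊢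
      rw [← map_add H p z, ← map_add H q z', map_add H p z, map_add H q z', hy, hy']
      simp only [a₁, a₂]
      match_scalars
      · field_simp
        linear_combination (f t * Complex.sin (β * t)) * hbb
          + (- f t * Complex.sin (β * t) * b' * b) * Complex.I_sq
      · field_simp
        ring
      · field_simp
        ring
      · field_simp
        ring
    rw [key]
    refine (norm_add_le _ _).trans ?_
    rw [norm_smul, norm_smul, norm_neg, norm_neg]
    simp only [norm_mul, hfn, hb'n, Complex.norm_I, Complex.norm_real, Real.norm_eq_abs,
      abs_of_pos hb0]
    have h1 := mul_le_mul_of_nonneg_right (hsn t) (mul_nonneg hb0.le (norm_nonneg z))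
    have h2 := mul_le_mul_of_nonneg_right (hcn t) (mul_nonneg hb0.le (norm_nonneg z'))
    nlinarith
  have hβτ : (β : ℂ) * τ = Real.pi / 2 := by
    rw [hτ]; push_cast; field_simp
  have h0 : a₁ 0 • (p + z) + a₂ 0 • (q + z') = p + z := by simp [a₁, a₂, f]
  have h1 : a₁ τ • (p + z) + a₂ τ • (q + z') = (f τ * (-Complex.I * (b' / β))) • (q + z') := by
    simp only [a₁, a₂, hβτ, Complex.cos_pi_div_two, Complex.sin_pi_div_two]
    simp
  simp only [h0, h1] at hmain
  have hc : ‖f τ * (-Complex.I * (b' / β))‖ = 1 := by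
    rw [norm_mul, norm_mul, norm_div, hfn, hb'n, norm_neg, Complex.norm_I, Complex.norm_real,
      Real.norm_eq_abs, abs_of_pos hb0, div_self hb0.ne']
    norm_num
  refine ⟨_, hc, ?_⟩
  set c := f τ * (-Complex.I * (b' / β))
  set U := NormedSpace.exp ((-Complex.I * (τ : ℂ)) • H)
  -- The factor `β` in the defect cancels the `1 / β` in the time. Together with one more `‖z‖ +
  -- ‖z'‖` for passing between bare and dressed vectors this gives the constant 3.
  have hβτ' : β * (‖z‖ + ‖z'‖) * τ ≤ 2 * (‖z‖ + ‖z'‖) := by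
    have : β * τ = Real.pi / 2 := by rw [hτ]; field_simp
    have h4 := Real.pi_le_four
    have h5 : 0 ≤ ‖z‖ + ‖z'‖ := by positivity
    calc β * (‖z‖ + ‖z'‖) * τ = β * τ * (‖z‖ + ‖z'‖) := by ring
      _ ≤ 2 * (‖z‖ + ‖z'‖) := by rw [this]; gcongr; linarith
  have hsplit : U p - c • q = (U (p + z) - c • (q + z')) - U z + c • z' := by
    rw [map_add, smul_add]; abel
  have hUz : ‖U z‖ = ‖z‖ := norm_exp_apply_eq H hH τ z
  rw [hsplit]
  have h6 := norm_add_le ((U (p + z) - c • (q + z')) - U z) (c • z')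
  have h7 := norm_sub_le (U (p + z) - c • (q + z')) (U z)
  rw [norm_smul, hc, one_mul] at h6
  linarith

end Evolution

/-! ### Resonant and isolated levels for an abstract gapped operator `D` perturbed by `W`. -/

section CoolingDynamics

variable {E : Type*} [NormedAddCommGroup E] [InnerProductSpace ℂ E]

/-- The perturbation `W` is small relative to the gap `Δ` outside the block `(1 - S) W (1 - S)`. -/
structure SmallOffBlocks (S W : E →L[ℂ] E) (Δ r β : ℝ) : Prop where
  symm_S : ∀ v w, inner ℂ (S v) w = inner ℂ v (S w)
  idem : ∀ v, S (S v) = S v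
  norm_S : ∀ v, ‖S v‖ ≤ ‖v‖
  symm_W : ∀ v w, inner ℂ (W v) w = inner ℂ v (W w)
  block11 : ∀ v, ‖S (W (S v))‖ ≤ 2 * r * Δ * ‖v‖
  block12 : ∀ v, ‖S (W (v - S v))‖ ≤ β * ‖v‖
  block21 : ∀ v, ‖W (S v) - S (W (S v))‖ ≤ β * ‖v‖
  block22 : ∀ v, ‖W (v - S v) - S (W (v - S v))‖ ≤ Δ / 2 * ‖v‖
  beta_le : β ≤ r * Δ

theorem SmallOffBlocks.norm_apply_le {S W : E →L[ℂ] E} {Δ r β : ℝ}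
    (h : SmallOffBlocks S W Δ r β) (v : E) : ‖W v‖ ≤ (1 / 2 + 4 * r) * Δ * ‖v‖ := by
  have h1 : W v = (S (W (S v)) + S (W (v - S v))) + ((W (S v) - S (W (S v)))
      + (W (v - S v) - S (W (v - S v)))) := by
    simp only [map_sub]; abel
  have h2 := norm_add_le (S (W (S v)) + S (W (v - S v))) ((W (S v) - S (W (S v)))
      + (W (v - S v) - S (W (v - S v))))
  have h3 := norm_add_le (S (W (S v))) (S (W (v - S v)))
  have h4 := norm_add_le (W (S v) - S (W (S v))) (W (v - S v) - S (W (v - S v)))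
  rw [h1]
  have h5 := mul_le_mul_of_nonneg_right h.beta_le (norm_nonneg v)
  linarith [h.block11 v, h.block12 v, h.block21 v, h.block22 v]

/-- On the range of `S` the only large block, of size `Δ / 2`, drops out, so `W` is of order `r Δ`
there. This is what makes the dressing corrections `O(r)`. -/
theorem SmallOffBlocks.norm_apply_le_of_mem {S W : E →L[ℂ] E} {Δ r β : ℝ}
    (h : SmallOffBlocks S W Δ r β) {v : E} (hv : S v = v) : ‖W v‖ ≤ 3 * r * Δ * ‖v‖ := by
  have h1 : W v = S (W (S v)) + (W (S v) - S (W (S v))) := by rw [hv]; abel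
  rw [h1]
  have h5 := mul_le_mul_of_nonneg_right h.beta_le (norm_nonneg v)
  linarith [h.block11 v, h.block21 v, norm_add_le (S (W (S v))) (W (S v) - S (W (S v)))]

/-- Lower bound on the effective coupling between two resonant dressed levels: the matrix element
`⟨p|W|q⟩` dominates all higher order processes. -/
theorem effective_coupling_lower_bound {S D W N : E →L[ℂ] E} {p q z : E} {Δ r β a b u : ℝ}
    {g : ℂ} (hΔ : 0 < Δ) (hr : 0 < r) (hr' : r ≤ 1 / 100) (hβ : 0 ≤ β)
    (hβ2 : β ^ 2 ≤ Δ * (r * (r * Δ) * a * b))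
    (ha : 0 < a) (ha' : a ≤ 1) (hb : 0 < b) (hb' : b ≤ 1)
    (h : SmallOffBlocks S W Δ r β)
    (hDsym : ∀ v w, inner ℂ (D v) w = inner ℂ v (D w)) (hSD : ∀ v, S (D v) = D (S v))
    (hNsym : ∀ v w, inner ℂ (N v) w = inner ℂ v (N w)) (hSN : ∀ v, S (N v) = N (S v))
    (hN : ∀ v, ‖N v‖ ≤ Δ / 8 * ‖v‖)
    (hSp : S p = p) (hSq : S q = q) (hp : ‖p‖ = 1) (hq : ‖q‖ = 1)
    (hDp : D p = 0) (hDq : D q = 0) (hNp : ∃ e : ℝ, N p = (e : ℂ) • p) (hNq : N q = (u : ℂ) • q)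
    (hgap : ∀ v, inner ℂ p v = 0 → inner ℂ q v = 0 → Δ * ‖v‖ ≤ ‖D v‖)
    (hpz : inner ℂ p z = 0) (hqz : inner ℂ q z = 0) (hz : ‖z‖ ≤ 1)
    (hWp : ‖S (W p)‖ ≤ r * Δ * a + r * (r * Δ) * a * b)
    (hWq : ‖S (W q)‖ ≤ r * Δ * b + r * (r * Δ) * a * b)
    (hWpq : r * Δ * a * b - r * (r * Δ) * a * b ≤ ‖inner ℂ p (W q)‖)
    (hres : D (q + z) + W (q + z) - N (q + z) = g • p) (hg : inner ℂ p (W (q + z)) = g) :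
    r * Δ * a * b / 2 ≤ ‖g‖ := by
  obtain ⟨e, hNp⟩ := hNp
  -- The size of all admissible corrections: smaller than the direct coupling `r Δ a b` by the
  -- factor `r`.
  set η := r * (r * Δ) * a * b with hη
  have hη0 : 0 < η := by positivity
  set z₁ := S z with hz₁
  set z₂ := z - S z with hz₂
  have hSz₂ : S z₂ = 0 := by rw [hz₂, map_sub, h.idem, sub_self]
  have hperp : ∀ v w, inner ℂ w v = 0 → S w = w → inner ℂ w (S v) = 0 := fun v w hv hw => by
    rw [← h.symm_S, hw, hv]
  have hpz₁ := hperp z p hpz hSp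
  have hqz₁ := hperp z q hqz hSq
  have hpz₂ : inner ℂ p z₂ = 0 := by rw [hz₂, inner_sub_right, hpz, hpz₁, sub_zero]
  have hqz₂ : inner ℂ q z₂ = 0 := by rw [hz₂, inner_sub_right, hqz, hqz₁, sub_zero]
  have hqz_norm : ‖q + z‖ ≤ 2 := (norm_add_le _ _).trans (by rw [hq]; linarith)
  rw [map_add D, map_add N, hDq, zero_add, hNq] at hres
  have hresS : D z₁ + S (W (q + z)) - ((u : ℂ) • q + N z₁) = g • p := by
    have h1 := congrArg S hres
    simp only [map_sub, map_smul, hSp] at h1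
    rw [map_add S (D z), map_add S ((u : ℂ) • q), map_smul, hSq, hSD, hSN] at h1
    exact h1
  -- component outside the range of `S`
  have hz₂b : 3 / 8 * Δ * ‖z₂‖ ≤ 2 * β := by
    -- The terms along `p` and `q` lie in the range of `S` and cancel. Since `N` costs `Δ / 8` and
    -- the remaining block of `W` costs `Δ / 2`, a margin `3 / 8 * Δ` is left.
    have h1 : D z₂ = N z₂ - (W (S (q + z)) - S (W (S (q + z))))
        - (W (z₂ - S z₂) - S (W (z₂ - S z₂))) := by
      have h2 : D z₂ = D z - D z₁ := by rw [hz₂, map_sub]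
      have h3 : N z₂ = N z - N z₁ := by rw [hz₂, map_sub]
      have h4 : W (q + z) = W (S (q + z)) + W z₂ := by
        rw [← map_add]; congr 1; rw [map_add, hSq, hz₂]; abel
      have h5 : D z = g • p + ((u : ℂ) • q + N z) - W (q + z) := by rw [← hres]; abel
      have h6 : D z₁ = g • p + ((u : ℂ) • q + N z₁) - S (W (q + z)) := by rw [← hresS]; abel
      rw [h2, h3, h5, h6, hSz₂, sub_zero, h4, map_add S (W (S (q + z)))]; abel
    have h2 := hgap z₂ hpz₂ hqz₂
    rw [h1] at h2
    have h3 := norm_sub_le (N z₂ - (W (S (q + z)) - S (W (S (q + z)))))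
      (W (z₂ - S z₂) - S (W (z₂ - S z₂)))
    have h4 := norm_sub_le (N z₂) (W (S (q + z)) - S (W (S (q + z))))
    have h5 := h.block21 (q + z)
    have h6 := h.block22 z₂
    have h7 := mul_le_mul_of_nonneg_left hqz_norm hβ
    linarith [hN z₂]
  have hβz₂ : β * ‖z₂‖ ≤ 16 / 3 * η := by
    have h1 : Δ * (β * ‖z₂‖) ≤ Δ * (16 / 3 * η) := by
      have := mul_le_mul_of_nonneg_left hz₂b hβ
      nlinarith
    exact le_of_mul_le_mul_left h1 hΔ
  -- component inside the range of `S`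
  have hz₁b : 3 / 4 * Δ * ‖z₁‖ ≤ r * Δ * b + 19 / 3 * η := by
    set y := D z₁ - N z₁ with hy
    have h1 : inner ℂ y p = 0 := by
      rw [hy, inner_sub_left, hDsym, hDp, inner_zero_right, hNsym, hNp, inner_smul_right,
        ← inner_conj_symm, hpz₁]; simp
    have h2 : inner ℂ y q = 0 := by
      rw [hy, inner_sub_left, hDsym, hDq, inner_zero_right, hNsym, hNq, inner_smul_right,
        ← inner_conj_symm, hqz₁]; simp
    have h3 : y = g • p + (u : ℂ) • q - S (W (q + z)) := by rw [← hresS, hy]; abel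
    -- The unknown terms `g • p` and `u • q` are orthogonal to `y`, so they do not enter the bound.
    have h4 : ‖y‖ ≤ ‖S (W (q + z))‖ := by
      have h5 : inner ℂ y y = - inner ℂ y (S (W (q + z))) := by
        nth_rewrite 2 [h3]
        rw [inner_sub_right, inner_add_right, inner_smul_right, inner_smul_right, h1, h2,
          mul_zero, mul_zero, add_zero, zero_sub]
      have h6 : ‖y‖ * ‖y‖ ≤ ‖y‖ * ‖S (W (q + z))‖ := by
        have h7 := norm_inner_le_norm (𝕜 := ℂ) y (S (W (q + z)))
        have h8 : ‖inner ℂ y y‖ = ‖y‖ * ‖y‖ := by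
          rw [inner_self_eq_norm_sq_to_K]; simp [sq]
        rw [← h8, h5, norm_neg]; exact h7
      rcases (norm_nonneg y).eq_or_lt with h0 | h0
      · rw [← h0]; exact norm_nonneg _
      · exact le_of_mul_le_mul_left h6 h0
    have h5 : S (W (q + z)) = S (W q) + S (W (S z₁)) + S (W (z₂ - S z₂)) := by
      rw [hSz₂, sub_zero, hz₁, h.idem, ← map_add, ← map_add, ← map_add, ← map_add, hz₂]
      congr 2; abel
    have h6 := norm_add_le (S (W q) + S (W (S z₁))) (S (W (z₂ - S z₂)))
    have h7 := norm_add_le (S (W q)) (S (W (S z₁)))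
    have h9 : ‖D z₁‖ ≤ ‖y‖ + ‖N z₁‖ := by
      have := norm_add_le y (N z₁)
      rwa [hy, sub_add_cancel] at this
    have h10 : r * Δ * ‖z₁‖ ≤ 1 / 100 * Δ * ‖z₁‖ := by gcongr
    rw [h5] at h4
    have h11 : 0 ≤ Δ * ‖z₁‖ := by positivity
    linarith [h.block11 z₁, h.block12 z₂, hgap z₁ hpz₁ hqz₁, hN z₁]
  have hgb : ‖inner ℂ p (W q)‖ ≤ ‖g‖ + (‖S (W p)‖ * ‖z₁‖ + β * ‖z₂‖) := by
    have h1 : inner ℂ p (W q) = g - (inner ℂ (S (W p)) z₁ + inner ℂ (W p - S (W p)) z₂) := by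
      have h2 : inner ℂ p (W z) = inner ℂ (S (W p)) z₁ + inner ℂ (W p - S (W p)) z₂ := by
        rw [← h.symm_W, hz₂, hz₁, inner_sub_left, inner_sub_right, inner_sub_right,
          h.symm_S (W p) (S z), h.idem, h.symm_S (W p) z]
        ring
      rw [← h2, ← hg, map_add, inner_add_right]; ring
    have h3 : ‖W p - S (W p)‖ ≤ β := by
      have := h.block21 p
      rwa [hSp, hp, mul_one] at this
    rw [h1]
    refine (norm_sub_le _ _).trans ?_
    gcongr
    refine (norm_add_le _ _).trans (add_le_add (norm_inner_le_norm _ _)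
      ((norm_inner_le_norm _ _).trans ?_))
    gcongr
  -- One factor carries `a`, the other `b`. The crude bound `O(r Δ)` on `W p` would lose them and
  -- could exceed the direct coupling.
  have hprod : ‖S (W p)‖ * ‖z₁‖ ≤ 2 * η := by
    have h1 : η ≤ 1 / 100 * (r * Δ * a) := by
      calc η = r * b * (r * Δ * a) := by rw [hη]; ring
        _ ≤ 1 / 100 * 1 * (r * Δ * a) := by gcongr
        _ = _ := by ring
    have h2 : η ≤ 1 / 100 * (r * Δ * b) := by
      calc η = r * a * (r * Δ * b) := by rw [hη]; ring
        _ ≤ 1 / 100 * 1 * (r * Δ * b) := by gcongr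
        _ = _ := by ring
    have h3 : ‖S (W p)‖ ≤ 101 / 100 * (r * Δ * a) := by linarith
    have h4 : 3 / 4 * Δ * ‖z₁‖ ≤ 11 / 10 * (r * Δ * b) := by
      have : 0 < r * Δ * b := by positivity
      linarith
    have h5 : ‖S (W p)‖ * (3 / 4 * Δ * ‖z₁‖)
        ≤ 101 / 100 * (r * Δ * a) * (11 / 10 * (r * Δ * b)) := by gcongr
    have h6 : 3 / 4 * Δ * (‖S (W p)‖ * ‖z₁‖) ≤ 3 / 4 * Δ * (2 * η) := by
      have h7 : 101 / 100 * (r * Δ * a) * (11 / 10 * (r * Δ * b)) = 1111 / 1000 * (Δ * η) := by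
        rw [hη]; ring
      have h8 : 0 < Δ * η := by positivity
      linarith
    exact le_of_mul_le_mul_left h6 (by positivity)
  have hηs : η ≤ 1 / 100 * (r * Δ * a * b) := by
    calc η = r * (r * Δ * a * b) := by rw [hη]; ring
      _ ≤ _ := by gcongr
  have hpos : 0 < r * Δ * a * b := by positivity
  linarith

variable [FiniteDimensional ℂ E]

/-- `D` preserves `F`, so projecting to `F` can only affect the `W` part, which the triangle
inequality controls. -/
theorem compression_lower_bound (F : Submodule ℂ E) (D W : E →L[ℂ] E) {Δ w κ : ℝ}
    (hD : ∀ v ∈ F, D v ∈ F) (hlow : ∀ v ∈ F, Δ * ‖v‖ ≤ ‖D v‖) (hW : ∀ v, ‖W v‖ ≤ w * ‖v‖)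
    (hκ : κ ≤ Δ - w) : ∀ v ∈ F, κ * ‖v‖ ≤ ‖F.starProjection ((D + W) v)‖ := by
  intro v hv
  have h1 : F.starProjection ((D + W) v) = D v + F.starProjection (W v) := by
    rw [add_apply, map_add, Submodule.starProjection_eq_self_iff.2 (hD v hv)]
  have h2 := norm_sub_le (D v + F.starProjection (W v)) (F.starProjection (W v))
  rw [add_sub_cancel_right] at h2
  have h3 := F.norm_starProjection_apply_le (W v)
  have h4 := mul_le_mul_of_nonneg_right hκ (norm_nonneg v)
  rw [h1]
  linarith [hlow v hv, hW v]

/-- A level that is well separated from the rest of the spectrum only acquires a phase, up to the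
relative size of the perturbation. -/
theorem isolated_level_evolution (H D W : E →L[ℂ] E) (p : E) {Δ s lam : ℝ} (hΔ : 0 < Δ)
    (hDsym : ∀ v w, inner ℂ (D v) w = inner ℂ v (D w))
    (hWsym : ∀ v w, inner ℂ (W v) w = inner ℂ v (W w))
    (hp : ‖p‖ = 1) (hDp : D p = 0) (hgap : ∀ v, inner ℂ p v = 0 → Δ * ‖v‖ ≤ ‖D v‖)
    (hW : ∀ v, ‖W v‖ ≤ 3 / 4 * Δ * ‖v‖) (hWp : ‖W p‖ ≤ s) (hs : s ≤ Δ / 16)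
    (hH : ∀ v, H v = (lam : ℂ) • v + D v + W v) {τ : ℝ} (hτ : 0 ≤ τ) :
    ∃ c : ℂ, ‖c‖ = 1 ∧
      ‖NormedSpace.exp ((-Complex.I * (τ : ℂ)) • H) p - c • p‖ ≤ 16 * s / Δ := by
  have : CompleteSpace E := FiniteDimensional.complete ℂ E
  have hHsym : ∀ v w, inner ℂ (H v) w = inner ℂ v (H w) := fun v w => by
    simp only [hH, inner_add_left, inner_add_right, hDsym, hWsym, inner_smul_left,
      inner_smul_right, Complex.conj_ofReal]
  let F : Submodule ℂ E := (ℂ ∙ p)ᗮ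
  have hF : ∀ v, v ∈ F ↔ inner ℂ p v = 0 := fun v =>
    Submodule.mem_orthogonal_singleton_iff_inner_right
  have hDF : ∀ v ∈ F, D v ∈ F := fun v _ => by
    rw [hF, ← hDsym, hDp, inner_zero_left]
  obtain ⟨e, z, -, hzF, hz, hres, hres'⟩ := exists_dressed_levels F (fun _ : Unit => p)
    (fun _ => hp) (fun _ v hv => by rw [← inner_conj_symm, (hF v).1 hv, map_zero]) (D + W)
    (fun v w => by simp only [add_apply, inner_add_left, inner_add_right, hDsym, hWsym])
    (fun _ => 1) (fun _ _ _ => rfl) (fun _ _ => by simp)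
    (fun e v => by
      have := norm_le_pi_norm e ()
      simp only [Finset.univ_unique, Finset.sum_singleton, one_apply_eq_self, norm_smul,
        Complex.norm_real]
      gcongr)
    (κ := Δ / 4) (s := s) (by positivity) (by linarith) (fun _ => by simpa [hDp] using hWp)
    (compression_lower_bound F D W hDF (fun v hv => hgap v ((hF v).1 hv)) hW (by linarith))
  replace hz := hz ()
  replace hres := hres ()
  replace hres' := hres' ()
  set y := p + z () with hy
  set x := (D + W) y - ∑ l, (e l : ℂ) • (1 : E →L[ℂ] E) y with hx
  -- With a single level, `F` is the whole complement of `p`; a residual orthogonal to both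
  -- vanishes, so the dressed vector is an exact eigenvector.
  have hx0 : x = 0 := by
    rw [← inner_self_eq_zero (𝕜 := ℂ)]
    exact hres x ((hF x).2 hres')
  have hHy : H y = ((lam + e () : ℝ) : ℂ) • y := by
    rw [hH]
    simp only [hx, Finset.univ_unique, Finset.sum_singleton, one_apply_eq_self, add_apply] at hx0
    rw [add_assoc, sub_eq_zero.1 hx0, ← add_smul, Complex.ofReal_add]
  have hU := exp_apply_eigenvector H hHsym hHy hτ
  set c := Complex.exp (-Complex.I * ((lam + e () : ℝ) : ℂ) * τ) with hc
  have hcn : ‖c‖ = 1 := by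
    have h1 : -Complex.I * ((lam + e () : ℝ) : ℂ) * τ
        = ((-(lam + e ()) * τ : ℝ) : ℂ) * Complex.I := by push_cast; ring
    rw [hc, h1, Complex.norm_exp_ofReal_mul_I]
  refine ⟨c, hcn, ?_⟩
  set U := NormedSpace.exp ((-Complex.I * (τ : ℂ)) • H) with hUdef
  have h2 : U p - c • p = c • z () - U (z ()) := by
    have h3 : U p = U y - U (z ()) := by rw [hy, map_add]; abel
    rw [h3, hU, hy, smul_add]; abel
  rw [h2]
  have h4 : ‖U (z ())‖ = ‖z ()‖ := norm_exp_apply_eq H hHsym τ _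
  refine (norm_sub_le _ _).trans ?_
  rw [norm_smul, hcn, h4, one_mul]
  calc ‖z ()‖ + ‖z ()‖ ≤ 2 * s / (Δ / 4) + 2 * s / (Δ / 4) := add_le_add hz hz
    _ = 16 * s / Δ := by field_simp; ring

/-- Tuning the two level shifts `e`, `u` makes the dressed versions of `p` and `q` resonant, and
the evolution then transfers `p` to `q` in a time inversely proportional to their coupling. -/
theorem exists_resonant_transfer {S D W n₀ n₁ : E →L[ℂ] E} {p q : E} {Δ r β a b : ℝ}
    (hΔ : 0 < Δ) (hr : 0 < r) (hr' : r ≤ 1 / 100) (hβ : 0 ≤ β)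
    (hβ2 : β ^ 2 ≤ Δ * (r * (r * Δ) * a * b))
    (ha : 0 < a) (ha' : a ≤ 1) (hb : 0 < b) (hb' : b ≤ 1)
    (h : SmallOffBlocks S W Δ r β)
    (hDsym : ∀ v w, inner ℂ (D v) w = inner ℂ v (D w)) (hSD : ∀ v, S (D v) = D (S v))
    (hn₀ : ∀ v w, inner ℂ (n₀ v) w = inner ℂ v (n₀ w)) (hSn₀ : ∀ v, S (n₀ v) = n₀ (S v))
    (hn₁ : ∀ v w, inner ℂ (n₁ v) w = inner ℂ v (n₁ w)) (hSn₁ : ∀ v, S (n₁ v) = n₁ (S v))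
    (hn : ∀ (e u c : ℝ) (v : E), |e| ≤ c → |u| ≤ c →
      ‖(e : ℂ) • n₀ v + (u : ℂ) • n₁ v‖ ≤ c * ‖v‖)
    (hn₀p : n₀ p = p) (hn₁p : n₁ p = 0) (hn₀q : n₀ q = 0) (hn₁q : n₁ q = q)
    (hSp : S p = p) (hSq : S q = q) (hp : ‖p‖ = 1) (hq : ‖q‖ = 1) (hpq : inner ℂ p q = 0)
    (hDp : D p = 0) (hDq : D q = 0)
    (hgap : ∀ v, inner ℂ p v = 0 → inner ℂ q v = 0 → Δ * ‖v‖ ≤ ‖D v‖)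
    (hWp : ‖S (W p)‖ ≤ r * Δ * a + r * (r * Δ) * a * b)
    (hWq : ‖S (W q)‖ ≤ r * Δ * b + r * (r * Δ) * a * b)
    (hWpq : r * Δ * a * b - r * (r * Δ) * a * b ≤ ‖inner ℂ p (W q)‖) :
    ∃ e u τ : ℝ, |e| ≤ 6 * r * Δ ∧ |u| ≤ 6 * r * Δ ∧ 0 < τ ∧ τ ≤ Real.pi / (r * Δ * a * b) ∧
      ∀ (H : E →L[ℂ] E) (lam : ℝ),
        (∀ v, H v = (lam : ℂ) • v + (D v + W v) - ((e : ℂ) • n₀ v + (u : ℂ) • n₁ v)) →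
        ∃ c : ℂ, ‖c‖ = 1 ∧
          ‖NormedSpace.exp ((-Complex.I * (τ : ℂ)) • H) p - c • q‖ ≤ 144 * r := by
  have : CompleteSpace E := FiniteDimensional.complete ℂ E
  have hqp : inner ℂ q p = 0 := by rw [← inner_conj_symm, hpq, map_zero]
  let F : Submodule ℂ E := (ℂ ∙ p)ᗮ ⊓ (ℂ ∙ q)ᗮ
  have hF : ∀ v, v ∈ F ↔ inner ℂ p v = 0 ∧ inner ℂ q v = 0 := fun v => by
    simp only [F, Submodule.mem_inf, Submodule.mem_orthogonal_singleton_iff_inner_right]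
  have hDF : ∀ v ∈ F, D v ∈ F := fun v _ => by
    rw [hF, ← hDsym, ← hDsym, hDp, hDq, inner_zero_left]
    exact ⟨rfl, rfl⟩
  have hrΔ : r * Δ ≤ 1 / 100 * Δ := by gcongr
  have hWn : ∀ v, ‖W v‖ ≤ 3 / 4 * Δ * ‖v‖ := fun v => (h.norm_apply_le v).trans <| by
    gcongr; linarith
  have hWpn := h.norm_apply_le_of_mem hSp
  have hWqn := h.norm_apply_le_of_mem hSq
  rw [hp, mul_one] at hWpn
  rw [hq, mul_one] at hWqn
  obtain ⟨e, z, he, hzF, hz, hres, hres'⟩ := exists_dressed_levels F ![p, q]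
    (fun i => by fin_cases i <;> simp [hp, hq])
    (fun i v hv => by
      rw [← inner_conj_symm]
      fin_cases i
      · simp [((hF v).1 hv).1]
      · simp [((hF v).1 hv).2]) (D + W)
    (fun v w => by simp only [add_apply, inner_add_left, inner_add_right, hDsym, h.symm_W])
    ![n₀, n₁] (fun i v w => by fin_cases i <;> simp [hn₀, hn₁])
    (fun i l => by fin_cases i <;> fin_cases l <;> simp [hn₀p, hn₁p, hn₀q, hn₁q])
    (fun e v => by
      rw [Fin.sum_univ_two]
      exact hn _ _ _ v (norm_le_pi_norm e 0) (norm_le_pi_norm e 1))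
    -- `D` is at least `Δ` on `F` and `W` at most `3 / 4 * Δ`, hence `κ`; the bound `s` is the one
    -- on `W p` and `W q`. These give `6 r Δ` for the shifts and `24 r` for each `z`.
    (κ := Δ / 4) (s := 3 * r * Δ) (by positivity) (by linarith)
    (fun i => by fin_cases i <;> simp [hDp, hDq, hWpn, hWqn])
    (compression_lower_bound F D W hDF (fun v hv => hgap v ((hF v).1 hv).1 ((hF v).1 hv).2) hWn
      (by linarith))
  have hz' : ∀ i, ‖z i‖ ≤ 24 * r := fun i => (hz i).trans_eq (by field_simp; norm_num)
  have hp0 := hres 0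
  have hq0 := hres 1
  have hp1 := hres' 0
  have hq1 := hres' 1
  simp only [Fin.sum_univ_two, Matrix.cons_val_zero, Matrix.cons_val_one, add_apply]
    at hp0 hq0 hp1 hq1
  let N : E →L[ℂ] E := (e 0 : ℂ) • n₀ + (e 1 : ℂ) • n₁
  have hNv : ∀ v, N v = (e 0 : ℂ) • n₀ v + (e 1 : ℂ) • n₁ v := fun _ => rfl
  simp only [← hNv] at hp0 hq0 hp1 hq1
  have hNp : N p = (e 0 : ℂ) • p := by simp [hNv, hn₀p, hn₁p]
  have hNq : N q = (e 1 : ℂ) • q := by simp [hNv, hn₀q, hn₁q]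
  have hNsym : ∀ v w, inner ℂ (N v) w = inner ℂ v (N w) := fun v w => by
    simp only [hNv, inner_add_left, inner_add_right, inner_smul_left, inner_smul_right,
      Complex.conj_ofReal, hn₀, hn₁]
  -- A residual orthogonal to `F` and to its own level can only point along the other level.
  have hspan : ∀ x a b : E, ‖a‖ = 1 → ‖b‖ = 1 → inner ℂ a b = 0 →
      (∀ v, inner ℂ a v = 0 → inner ℂ b v = 0 → inner ℂ v x = 0) → inner ℂ a x = 0 →
      x = inner ℂ b x • b := by
    intro x a b ha hb hab hx hax
    have h1 : inner ℂ a (x - inner ℂ b x • b) = 0 := by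
      rw [inner_sub_right, inner_smul_right, hab, hax]; simp
    have h2 : inner ℂ b (x - inner ℂ b x • b) = 0 := by
      rw [inner_sub_right, inner_smul_right, inner_self_eq_norm_sq_to_K, hb]; simp
    have h3 := hx _ h1 h2
    have h4 : inner ℂ (x - inner ℂ b x • b) (x - inner ℂ b x • b) = 0 := by
      rw [inner_sub_right (x - inner ℂ b x • b), h3, inner_smul_right,
        ← inner_conj_symm _ b, h2]; simp
    exact sub_eq_zero.1 (inner_self_eq_zero.1 h4)
  have hyp := hspan _ p q hp hq hpq (fun v hv hv' => hp0 v ((hF v).2 ⟨hv, hv'⟩)) hp1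
  have hyq := hspan _ q p hq hp hqp (fun v hv hv' => hq0 v ((hF v).2 ⟨hv', hv⟩)) hq1
  set y := p + z 0 with hy
  set y' := q + z 1 with hy'
  set g := inner ℂ p (D y' + W y' - N y') with hg
  set g' := inner ℂ q (D y + W y - N y) with hg'
  obtain ⟨hpz0, hqz0⟩ := (hF _).1 (hzF 0)
  obtain ⟨hpz1, hqz1⟩ := (hF _).1 (hzF 1)
  -- Both couplings are the same matrix element of the symmetric operator `D + W - N` between the
  -- two dressed vectors, read in opposite orders.
  have hgg : g' = starRingEnd ℂ g := by
    have h1 : inner ℂ y' (D y + W y - N y) = g' := by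
      rw [hyp, inner_smul_right, hy', inner_add_left, inner_self_eq_norm_sq_to_K, hq,
        ← inner_conj_symm (z 1), hqz1]
      simp
    have h2 : inner ℂ y' (D y + W y - N y) = starRingEnd ℂ g := by
      have h3 : inner ℂ y' (D y + W y - N y) = inner ℂ (D y' + W y' - N y') y := by
        simp only [inner_sub_left, inner_sub_right, inner_add_left, inner_add_right, hDsym,
          h.symm_W, hNsym]
      rw [h3, hyq, inner_smul_left, hy, inner_add_right, inner_self_eq_norm_sq_to_K, hp, hpz0]
      simp
    rw [← h1, h2]
  have hgW : inner ℂ p (W y') = g := by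
    rw [hg, inner_sub_right, inner_add_right, ← hDsym, hDp, inner_zero_left, ← hNsym, hNp,
      inner_smul_left, hy', inner_add_right p q, hpq, hpz1]
    simp [inner_add_right]
  have he' : ∀ i, |e i| ≤ Δ / 8 := fun i => (he i).trans (by linarith)
  have hglow := effective_coupling_lower_bound (N := N) (u := e 1) (z := z 1) (g := g)
    hΔ hr hr' hβ hβ2 ha ha' hb hb' h hDsym hSD hNsym
    (fun v => by simp only [hNv, map_add, map_smul, hSn₀, hSn₁])
    (fun v => hn _ _ _ v (he' 0) (he' 1)) hSp hSq hp hq hDp hDq ⟨_, hNp⟩ hNq hgap hpz1 hqz1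
    ((hz' 1).trans (by linarith)) hWp hWq hWpq hyq hgW
  have hpos : 0 < r * Δ * a * b := by positivity
  have hgpos : 0 < ‖g‖ := by linarith
  refine ⟨e 0, e 1, Real.pi / (2 * ‖g‖), (he 0).trans_eq (by ring), (he 1).trans_eq (by ring),
    by positivity, ?_, ?_⟩
  · exact div_le_div_of_nonneg_left Real.pi_pos.le hpos (by linarith)
  intro H lam hH
  have hH' : ∀ v, H v = (lam : ℂ) • v + (D v + W v - N v) := fun v => by
    rw [hH, hNv]; abel
  have hHsym : ∀ v w, inner ℂ (H v) w = inner ℂ v (H w) := fun v w => by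
    simp only [hH', inner_add_left, inner_add_right, inner_sub_left, inner_sub_right, hDsym,
      h.symm_W, hNsym, inner_smul_left, inner_smul_right, Complex.conj_ofReal]
  obtain ⟨c, hc, hc'⟩ := norm_exp_apply_sub_le_of_resonant H hHsym (p := p) (q := q) (z := z 0)
    (z' := z 1) (E₀ := lam) (norm_pos_iff.1 hgpos)
    (by rw [hH', ← hgg]; exact congrArg _ hyp) (by rw [hH']; exact congrArg _ hyq)
  exact ⟨c, hc, hc'.trans (by linarith [hz' 0, hz' 1])⟩

end CoolingDynamics

/-! ### States and operators on system and bath, split into bath components. -/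

section JointSystem

/-- State vectors of the system together with the bath qubit. -/
abbrev JointVec (n : ℕ) : Type := EuclideanSpace ℂ (Qubits n × Fin 2)

/-- The operator on Euclidean space given by a matrix. -/
noncomputable abbrev toOp {ι : Type*} [Fintype ι] [DecidableEq ι] (A : Matrix ι ι ℂ) :
    EuclideanSpace ℂ ι →L[ℂ] EuclideanSpace ℂ ι :=
  Matrix.toEuclideanCLM (𝕜 := ℂ) A

variable {n L : ℕ}

/-- The component of a joint state at the bath state `s`. -/
noncomputable def bathComponent (s : Fin 2) : JointVec n →ₗ[ℂ] SysVec n where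
  toFun v := WithLp.toLp 2 fun a => v (a, s)
  map_add' _ _ := rfl
  map_smul' _ _ := rfl

/-- The joint state with system state `u` and bath state `s`. -/
noncomputable def withBath (s : Fin 2) : SysVec n →ₗ[ℂ] JointVec n where
  toFun u := WithLp.toLp 2 fun i => if i.2 = s then u i.1 else 0
  map_add' u v := by ext i; by_cases h : i.2 = s <;> simp [h]
  map_smul' c v := by ext i; by_cases h : i.2 = s <;> simp [h]

theorem bathComponent_apply (s : Fin 2) (v : JointVec n) (a : Qubits n) :
    bathComponent s v a = v (a, s) := rfl

theorem withBath_apply (s : Fin 2) (u : SysVec n) (i : Qubits n × Fin 2) :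
    withBath s u i = if i.2 = s then u i.1 else 0 := rfl

@[simp]
theorem bathComponent_withBath (s t : Fin 2) (u : SysVec n) :
    bathComponent s (withBath t u) = if s = t then u else 0 := by
  ext a
  rw [bathComponent_apply, withBath_apply]
  by_cases h : s = t <;> simp [h]

theorem jointVec_ext {v w : JointVec n} (h : ∀ s, bathComponent s v = bathComponent s w) :
    v = w := by
  ext ⟨a, s⟩
  exact congrArg (fun u : SysVec n => u a) (h s)

theorem inner_eq_sum_bathComponent (v w : JointVec n) :
    inner ℂ v w = ∑ s, inner ℂ (bathComponent s v) (bathComponent s w) := by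
  simp only [PiLp.inner_apply, bathComponent_apply]
  rw [Fintype.sum_prod_type, Finset.sum_comm]

theorem norm_sq_eq_sum_bathComponent (v : JointVec n) :
    ‖v‖ ^ 2 = ∑ s, ‖bathComponent s v‖ ^ 2 := by
  have h := inner_eq_sum_bathComponent v v
  simp only [inner_self_eq_norm_sq_to_K] at h
  exact_mod_cast h

/-- Used for the gap bounds: the unperturbed operators are block diagonal in the bath, so `↓` and
`↑` can be treated separately. -/
theorem norm_le_of_bathComponent {v w : JointVec n} {c : ℝ} (hc : 0 ≤ c)
    (h : ∀ s, c * ‖bathComponent s v‖ ≤ ‖bathComponent s w‖) : c * ‖v‖ ≤ ‖w‖ := by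
  refine le_of_sq_le_sq ?_ (norm_nonneg _)
  rw [mul_pow, norm_sq_eq_sum_bathComponent v, norm_sq_eq_sum_bathComponent w, Finset.mul_sum]
  refine Finset.sum_le_sum fun s _ => ?_
  rw [← mul_pow]
  exact pow_le_pow_left₀ (by positivity) (h s) 2

@[simp]
theorem norm_withBath (s : Fin 2) (u : SysVec n) : ‖withBath s u‖ = ‖u‖ := by
  rw [← sq_eq_sq₀ (norm_nonneg _) (norm_nonneg _), norm_sq_eq_sum_bathComponent]
  fin_cases s <;> simp

theorem inner_withBath_left (s : Fin 2) (u : SysVec n) (v : JointVec n) :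
    inner ℂ (withBath s u) v = inner ℂ u (bathComponent s v) := by
  rw [inner_eq_sum_bathComponent]
  fin_cases s <;> simp

theorem bathComponent_kronecker (A : SysOp n) (B : Matrix (Fin 2) (Fin 2) ℂ) (v : JointVec n)
    (s : Fin 2) :
    bathComponent s (toOp (A ⊗ₖ B) v) = ∑ t, B s t • toOp A (bathComponent t v) := by
  ext a
  simp only [bathComponent_apply, Matrix.ofLp_toEuclideanCLM,
    Matrix.mulVec, dotProduct, Fintype.sum_prod_type, Matrix.kroneckerMap_apply, Fin.sum_univ_two,
    PiLp.add_apply, PiLp.smul_apply, smul_eq_mul, Finset.mul_sum, Finset.sum_add_distrib]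
  congr 1 <;> exact Finset.sum_congr rfl fun i _ => by ring

theorem inner_toOp_of_isHermitian {ι : Type*} [Fintype ι] [DecidableEq ι] {A : Matrix ι ι ℂ}
    (hA : A.IsHermitian) (v w : EuclideanSpace ℂ ι) :
    inner ℂ (toOp A v) w = inner ℂ v (toOp A w) := by
  have h : star (toOp A) = toOp A := by
    rw [← map_star]; exact congrArg _ hA
  exact (ContinuousLinearMap.isSelfAdjoint_iff_isSymmetric (A := toOp A)).1 h v w

theorem toOp_mul_apply {ι : Type*} [Fintype ι] [DecidableEq ι] (A B : Matrix ι ι ℂ)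
    (v : EuclideanSpace ℂ ι) : toOp (A * B) v = toOp A (toOp B v) := by
  rw [toOp, map_mul]; rfl

theorem norm_toOp_apply_le {ι : Type*} [Fintype ι] [DecidableEq ι] (A : Matrix ι ι ℂ)
    (v : EuclideanSpace ℂ ι) : ‖toOp A v‖ ≤ ‖A‖ * ‖v‖ :=
  (toOp A).le_opNorm v

theorem toOp_ketbra_apply (u v w : SysVec n) : toOp (ketbra u v) w = inner ℂ v w • u := by
  ext a
  simp only [Matrix.ofLp_toEuclideanCLM, ketbra, Matrix.mulVec, dotProduct, Matrix.vecMulVec_apply,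
    PiLp.smul_apply, smul_eq_mul, PiLp.inner_apply, Finset.sum_mul, Pi.star_apply,
    RCLike.inner_apply, RCLike.star_def]
  exact Finset.sum_congr rfl fun i _ => by ring

theorem isHermitian_ketbra (u : SysVec n) : (ketbra u u).IsHermitian := by
  rw [Matrix.IsHermitian, ketbra, Matrix.conjTranspose_vecMulVec, star_star]

theorem isHermitian_kronecker {A : SysOp n} {B : Matrix (Fin 2) (Fin 2) ℂ} (hA : A.IsHermitian)
    (hB : B.IsHermitian) : (A ⊗ₖ B).IsHermitian := by
  rw [Matrix.IsHermitian, Matrix.conjTranspose_kronecker, hA.eq, hB.eq]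

theorem isHermitian_bathUp : bathUp.IsHermitian := by
  ext i j; fin_cases i <;> fin_cases j <;> simp [bathUp]

theorem isHermitian_bathDown : bathDown.IsHermitian := by
  ext i j; fin_cases i <;> fin_cases j <;> simp [bathDown]

theorem isHermitian_sigmaX : sigmaX.IsHermitian := by
  ext i j; fin_cases i <;> fin_cases j <;> simp [sigmaX]

end JointSystem

/-! ### The projector onto `S₁`. -/

section Projector

variable {n L : ℕ} {ket : Fin (L + 1) → SysVec n}

theorem toOp_projS1_apply (v : SysVec n) :
    toOp (projS1 ket) v = ∑ j, inner ℂ (ket j) v • ket j := by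
  have h : toOp (projS1 ket) = ∑ j, toOp (ketbra (ket j) (ket j)) := map_sum _ _ _
  rw [h, _root_.sum_apply]
  exact Finset.sum_congr rfl fun j _ => toOp_ketbra_apply _ _ _

theorem isHermitian_projS1 : (projS1 ket).IsHermitian := by
  rw [Matrix.IsHermitian, projS1, Matrix.conjTranspose_sum]
  exact Finset.sum_congr rfl fun j _ => isHermitian_ketbra _

theorem toOp_projS1_ket (h : Orthonormal ℂ ket) (j : Fin (L + 1)) :
    toOp (projS1 ket) (ket j) = ket j := by
  rw [toOp_projS1_apply]
  simp [orthonormal_iff_ite.1 h]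

theorem toOp_projS1_idem (h : Orthonormal ℂ ket) (v : SysVec n) :
    toOp (projS1 ket) (toOp (projS1 ket) v) = toOp (projS1 ket) v := by
  conv_lhs => rw [toOp_projS1_apply (ket := ket) v]
  rw [map_sum]
  simp only [map_smul, toOp_projS1_ket h]
  rw [toOp_projS1_apply]

theorem norm_le_of_symm_idem {E : Type*} [NormedAddCommGroup E] [InnerProductSpace ℂ E]
    (S : E →L[ℂ] E) (hS : ∀ v w, inner ℂ (S v) w = inner ℂ v (S w)) (hS' : ∀ v, S (S v) = S v)
    (v : E) : ‖S v‖ ≤ ‖v‖ := by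
  have h1 : ‖S v‖ * ‖S v‖ ≤ ‖v‖ * ‖S v‖ := by
    have h2 : ‖inner ℂ (S v) (S v)‖ = ‖S v‖ * ‖S v‖ := by
      rw [inner_self_eq_norm_sq_to_K]; simp [sq]
    rw [← h2, hS, hS']
    exact norm_inner_le_norm _ _
  rcases (norm_nonneg (S v)).eq_or_lt with h0 | h0
  · rw [← h0]; exact norm_nonneg _
  · exact le_of_mul_le_mul_right h1 h0

end Projector

/-! ### Spectral bounds for `H_S`. -/

section Spectrum

variable {n L : ℕ} {HS : SysOp n} {ket : Fin (L + 1) → SysVec n} {ω : Fin (L + 1) → ℝ} {Δ : ℝ}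

theorem IsResolvedBand.apply_ket (h : IsResolvedBand HS ket ω Δ) (j : Fin (L + 1)) :
    toOp HS (ket j) = (ω j : ℂ) • ket j := by
  have h1 : HS * projS1 ket = ∑ i, (ω i : ℂ) • ketbra (ket i) (ket i) := by
    rw [← h.block, ← h.invariant.eq, mul_assoc]
    congr 1
    apply (Matrix.toEuclideanCLM (𝕜 := ℂ) (n := Qubits n)).injective
    ext1 v
    exact ((toOp_mul_apply _ _ _).trans (toOp_projS1_idem h.orthonormal v)).symm
  have h2 := congrArg (fun A => toOp A (ket j)) h1
  simp only [toOp_mul_apply, toOp_projS1_ket h.orthonormal] at h2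
  rw [h2]
  have h3 : toOp (∑ i, (ω i : ℂ) • ketbra (ket i) (ket i))
      = ∑ i, (ω i : ℂ) • toOp (ketbra (ket i) (ket i)) := by
    simp only [toOp, map_sum, map_smul]
  rw [h3, _root_.sum_apply]
  simp only [_root_.smul_apply, toOp_ketbra_apply,
    orthonormal_iff_ite.1 h.orthonormal]
  simp

theorem toOp_eigenvectorBasis (hA : HS.IsHermitian) (i : Qubits n) :
    toOp HS (hA.eigenvectorBasis i) = (hA.eigenvalues i : ℂ) • hA.eigenvectorBasis i := by
  ext a
  rw [Matrix.ofLp_toEuclideanCLM, hA.mulVec_eigenvectorBasis i]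
  simp

/-- Lower bound on a shifted Hermitian operator from the distance to its eigenvalues. -/
theorem norm_shift_lower_bound (hA : HS.IsHermitian) {a c : ℝ} (hc : 0 ≤ c) (v : SysVec n)
    (h : ∀ i, inner ℂ (hA.eigenvectorBasis i) v = 0 ∨ c ≤ |hA.eigenvalues i + a|) :
    c * ‖v‖ ≤ ‖toOp HS v + (a : ℂ) • v‖ := by
  refine le_of_sq_le_sq ?_ (norm_nonneg _)
  rw [mul_pow, ← hA.eigenvectorBasis.sum_sq_norm_inner_right v,
    ← hA.eigenvectorBasis.sum_sq_norm_inner_right (toOp HS v + (a : ℂ) • v), Finset.mul_sum]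
  refine Finset.sum_le_sum fun i _ => ?_
  have h1 : inner ℂ (hA.eigenvectorBasis i) (toOp HS v + (a : ℂ) • v)
      = ((hA.eigenvalues i + a : ℝ) : ℂ) * inner ℂ (hA.eigenvectorBasis i) v := by
    rw [inner_add_right, inner_smul_right, ← inner_toOp_of_isHermitian hA,
      toOp_eigenvectorBasis, inner_smul_left]
    simp; ring
  rw [h1, norm_mul, mul_pow, Complex.norm_real, Real.norm_eq_abs]
  rcases h i with h2 | h2
  · rw [h2]; simp
  · gcongr

/-- By nondegeneracy every eigenvector at `ω j` is a multiple of `ket j`, hence orthogonal to `v`;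
all remaining eigenvalues are at distance at least `Δ`. -/
theorem IsResolvedBand.gap_le (h : IsResolvedBand HS ket ω Δ) (j : Fin (L + 1)) (v : SysVec n)
    (hv : inner ℂ (ket j) v = 0) : Δ * ‖v‖ ≤ ‖toOp HS v - (ω j : ℂ) • v‖ := by
  have h1 := norm_shift_lower_bound h.isHermitian (a := -ω j) h.gap_pos.le v fun i => by
    by_cases hi : h.isHermitian.eigenvalues i = ω j
    · left
      have hmem : ∀ u : SysVec n, toOp HS u = (ω j : ℂ) • u →
          u.ofLp ∈ Module.End.eigenspace (Matrix.toLin' HS) (ω j : ℂ) := fun u hu => by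
        rw [Module.End.mem_eigenspace_iff, Matrix.toLin'_apply, ← Matrix.ofLp_toEuclideanCLM, hu]
        rfl
      have hk := hmem _ (h.apply_ket j)
      have hb := hmem _ (hi ▸ toOp_eigenvectorBasis h.isHermitian i)
      have hk0 : (⟨_, hk⟩ : Module.End.eigenspace (Matrix.toLin' HS) (ω j : ℂ)) ≠ 0 := by
        intro h0
        have h2 : (ket j).ofLp = 0 := congrArg Subtype.val h0
        have h3 : ket j = 0 := by ext a; exact congrFun h2 a
        exact h.orthonormal.ne_zero j h3
      obtain ⟨c, hc⟩ := (finrank_eq_one_iff_of_nonzero' _ hk0).1 (h.nondegenerate j) ⟨_, hb⟩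
      have hc' : h.isHermitian.eigenvectorBasis i = c • ket j := by
        ext a
        exact (congrFun (congrArg Subtype.val hc) a).symm
      rw [hc', inner_smul_left, hv, mul_zero]
    · right
      rw [← sub_eq_add_neg]
      exact h.gap.2 ⟨j, _, h.isHermitian.eigenvalues_mem_spectrum_real i, hi, rfl⟩
  rwa [Complex.ofReal_neg, neg_smul, ← sub_eq_add_neg] at h1

/-- This is where the ground-state hypothesis enters: `H_S ≥ 0`, so a positive shift only moves the
spectrum away from zero. -/
theorem IsResolvedBand.shift_le (h : IsResolvedBand HS ket ω Δ) {a : ℝ} (ha : 0 ≤ a)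
    (v : SysVec n) : a * ‖v‖ ≤ ‖toOp HS v + (a : ℂ) • v‖ :=
  norm_shift_lower_bound h.isHermitian ha v fun i => by
    right
    have h1 := h.ground _ (h.isHermitian.eigenvalues_mem_spectrum_real i)
    rw [h.zero_level] at h1
    exact (by linarith : a ≤ h.isHermitian.eigenvalues i + a).trans (le_abs_self _)

theorem IsResolvedBand.level_gap (h : IsResolvedBand HS ket ω Δ) {i j : Fin (L + 1)}
    (hij : i < j) : Δ ≤ ω j - ω i := by
  have h1 := h.gap_le i (ket j) (h.orthonormal.2 hij.ne)
  rw [h.apply_ket, ← sub_smul, norm_smul, h.orthonormal.1, mul_one, mul_one,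
    ← Complex.ofReal_sub, Complex.norm_real, Real.norm_eq_abs,
    abs_of_pos (sub_pos.2 (h.strictMono hij))] at h1
  exact h1

end Spectrum

/-! ### Action of the bath operators on components and product states. -/

section BathOperators

variable {n : ℕ}

theorem bathComponent_down (v : JointVec n) (s : Fin 2) :
    bathComponent s (toOp ((1 : SysOp n) ⊗ₖ bathDown) v)
      = if s = 0 then bathComponent s v else 0 := by
  rw [bathComponent_kronecker]
  fin_cases s <;> simp [bathDown]

theorem bathComponent_up (v : JointVec n) (s : Fin 2) :
    bathComponent s (toOp ((1 : SysOp n) ⊗ₖ bathUp) v)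
      = if s = 1 then bathComponent s v else 0 := by
  rw [bathComponent_kronecker]
  fin_cases s <;> simp [bathUp]

theorem bathComponent_system (A : SysOp n) (v : JointVec n) (s : Fin 2) :
    bathComponent s (toOp (A ⊗ₖ (1 : Matrix (Fin 2) (Fin 2) ℂ)) v)
      = toOp A (bathComponent s v) := by
  rw [bathComponent_kronecker]
  simp [Matrix.one_apply]

theorem bathComponent_sigmaX (A : SysOp n) (v : JointVec n) (s : Fin 2) :
    bathComponent s (toOp (A ⊗ₖ sigmaX) v) = toOp A (bathComponent (1 - s) v) := by
  rw [bathComponent_kronecker]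
  fin_cases s <;> simp [sigmaX]

theorem system_withBath (A : SysOp n) (s : Fin 2) (u : SysVec n) :
    toOp (A ⊗ₖ (1 : Matrix (Fin 2) (Fin 2) ℂ)) (withBath s u) = withBath s (toOp A u) :=
  jointVec_ext fun t => by
    rw [bathComponent_system, bathComponent_withBath, bathComponent_withBath]
    split_ifs <;> simp

theorem down_withBath (s : Fin 2) (u : SysVec n) :
    toOp ((1 : SysOp n) ⊗ₖ bathDown) (withBath s u) = if s = 0 then withBath s u else 0 :=
  jointVec_ext fun t => by
    rw [bathComponent_down, bathComponent_withBath]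
    fin_cases s <;> fin_cases t <;> simp

theorem up_withBath (s : Fin 2) (u : SysVec n) :
    toOp ((1 : SysOp n) ⊗ₖ bathUp) (withBath s u) = if s = 1 then withBath s u else 0 :=
  jointVec_ext fun t => by
    rw [bathComponent_up, bathComponent_withBath]
    fin_cases s <;> fin_cases t <;> simp

theorem norm_down_add_up_le (e u c : ℝ) (v : JointVec n) (he : |e| ≤ c) (hu : |u| ≤ c) :
    ‖(e : ℂ) • toOp ((1 : SysOp n) ⊗ₖ bathDown) v + (u : ℂ) • toOp ((1 : SysOp n) ⊗ₖ bathUp) v‖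
      ≤ c * ‖v‖ := by
  have hc : 0 ≤ c := (abs_nonneg _).trans he
  refine le_of_sq_le_sq ?_ (by positivity)
  rw [mul_pow, norm_sq_eq_sum_bathComponent v, norm_sq_eq_sum_bathComponent, Finset.mul_sum]
  refine Finset.sum_le_sum fun s _ => ?_
  rw [← mul_pow, map_add, map_smul, map_smul, bathComponent_down, bathComponent_up]
  refine pow_le_pow_left₀ (norm_nonneg _) ?_ 2
  fin_cases s
  · simpa [norm_smul] using mul_le_mul_of_nonneg_right he (norm_nonneg (bathComponent 0 v))
  · simpa [norm_smul] using mul_le_mul_of_nonneg_right hu (norm_nonneg (bathComponent 1 v))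

end BathOperators

/-! ### Size of the interaction blocks and passage from matrices to operators. -/

section CoolingStep

variable {n L : ℕ} {HS TS : SysOp n} {ket : Fin (L + 1) → SysVec n} {ω : Fin (L + 1) → ℝ}
  {x : Fin (L + 1) → ℂ} {Δ Ω₀ : ℝ} {δ : JointOp n}

theorem inner_ket_stateG (h : Orthonormal ℂ ket) (j : Fin (L + 1)) :
    inner ℂ (ket j) (stateG ket x) = x j := by
  rw [stateG, inner_sum]
  simp [inner_smul_right, orthonormal_iff_ite.1 h]

theorem IsCoupling.coeff_le_one (h : Orthonormal ℂ ket) (hC : IsCoupling ket x Ω₀ TS)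
    (j : Fin (L + 1)) : ‖x j‖ ≤ 1 := by
  rw [← inner_ket_stateG (x := x) h j]
  exact (norm_inner_le_norm _ _).trans (by rw [h.1, hC.normalized, mul_one])

/-- The compression of the interaction to `S₁` is the rank-one coupling plus the error term. -/
theorem compressed_interaction (hC : IsCoupling ket x Ω₀ TS) (v : JointVec n) :
    toOp (projS1 ket ⊗ₖ (1 : Matrix (Fin 2) (Fin 2) ℂ)) (toOp (TS ⊗ₖ sigmaX + δ)
        (toOp (projS1 ket ⊗ₖ (1 : Matrix (Fin 2) (Fin 2) ℂ)) v))
      = toOp (((Ω₀ : ℂ) • ketbra (stateG ket x) (stateG ket x)) ⊗ₖ sigmaX) v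
        + toOp ((projS1 ket ⊗ₖ (1 : Matrix (Fin 2) (Fin 2) ℂ)) * δ *
            (projS1 ket ⊗ₖ (1 : Matrix (Fin 2) (Fin 2) ℂ))) v := by
  rw [← toOp_mul_apply, ← toOp_mul_apply, ← add_apply, ← hC.block, mul_add, add_mul,
    ← Matrix.mul_kronecker_mul, ← Matrix.mul_kronecker_mul, one_mul, mul_one]
  simp only [toOp, map_add]

theorem rankOne_apply (g : SysVec n) (v : JointVec n) (s : Fin 2) :
    bathComponent s (toOp (((Ω₀ : ℂ) • ketbra g g) ⊗ₖ sigmaX) v)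
      = ((Ω₀ : ℂ) * inner ℂ g (bathComponent (1 - s) v)) • g := by
  rw [bathComponent_sigmaX]
  have h : toOp ((Ω₀ : ℂ) • ketbra g g) = (Ω₀ : ℂ) • toOp (ketbra g g) := map_smul _ _ _
  rw [h, _root_.smul_apply, toOp_ketbra_apply, smul_smul]

theorem norm_rankOne_apply_le (hΩ : 0 ≤ Ω₀) {g : SysVec n} (hg : ‖g‖ = 1) (v : JointVec n) :
    ‖toOp (((Ω₀ : ℂ) • ketbra g g) ⊗ₖ sigmaX) v‖ ≤ Ω₀ * ‖v‖ := by
  refine le_of_sq_le_sq ?_ (by positivity)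
  rw [mul_pow, norm_sq_eq_sum_bathComponent v, norm_sq_eq_sum_bathComponent]
  simp only [rankOne_apply, norm_smul, norm_mul, hg, mul_one, mul_pow, Complex.norm_real,
    Real.norm_eq_abs, sq_abs, Fin.sum_univ_two]
  have h1 : ∀ u : SysVec n, ‖inner ℂ g u‖ ^ 2 ≤ ‖u‖ ^ 2 := fun u =>
    pow_le_pow_left₀ (norm_nonneg _) ((norm_inner_le_norm g u).trans (by rw [hg, one_mul])) 2
  have h2 := mul_le_mul_of_nonneg_left (h1 (bathComponent 0 v)) (sq_nonneg Ω₀)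
  have h3 := mul_le_mul_of_nonneg_left (h1 (bathComponent 1 v)) (sq_nonneg Ω₀)
  norm_num
  linarith

theorem rankOne_withBath (g u : SysVec n) (s : Fin 2) :
    toOp (((Ω₀ : ℂ) • ketbra g g) ⊗ₖ sigmaX) (withBath s u)
      = ((Ω₀ : ℂ) * inner ℂ g u) • withBath (1 - s) g :=
  jointVec_ext fun t => by
    rw [rankOne_apply, map_smul, bathComponent_withBath, bathComponent_withBath]
    fin_cases s <;> fin_cases t <;> simp

theorem projS2_kronecker_apply (v : JointVec n) :
    toOp (projS2 ket ⊗ₖ (1 : Matrix (Fin 2) (Fin 2) ℂ)) v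
      = v - toOp (projS1 ket ⊗ₖ (1 : Matrix (Fin 2) (Fin 2) ℂ)) v := by
  have h : projS2 ket ⊗ₖ (1 : Matrix (Fin 2) (Fin 2) ℂ)
      = 1 - projS1 ket ⊗ₖ (1 : Matrix (Fin 2) (Fin 2) ℂ) := by
    rw [projS2, sub_eq_add_neg, Matrix.add_kronecker, Matrix.one_kronecker_one, sub_eq_add_neg]
    congr 1
    ext i j
    simp [Matrix.kroneckerMap_apply]
  rw [h]
  simp only [toOp, map_sub, map_one]
  rfl

theorem ErrorBound.norm_compressed_le {x0 xj : ℂ} (hΔ : 0 < Δ)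
    (hE : ErrorBound ket x0 xj Δ Ω₀ TS δ) :
    ‖(projS1 ket ⊗ₖ (1 : Matrix (Fin 2) (Fin 2) ℂ)) * δ *
      (projS1 ket ⊗ₖ (1 : Matrix (Fin 2) (Fin 2) ℂ))‖
      ≤ Ω₀ / Δ * (Ω₀ / Δ * Δ) * ‖xj‖ * ‖x0‖ := by
  have h := (div_lt_iff₀ hΔ).1 hE.block11
  rw [norm_mul x0 xj] at h
  refine h.le.trans_eq ?_
  field_simp

/-- Take `β` to be the norm of the `S₁`–`S₂` block, which equals that of its adjoint. Within `S₁`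
the rank-one coupling and the error term contribute at most `Ω₀` each. The sharper bound on `β ^ 2`,
with its factors `‖x j‖` and `‖x 0‖`, is kept for the effective coupling. -/
theorem ErrorBound.smallOffBlocks (h : Orthonormal ℂ ket) (hC : IsCoupling ket x Ω₀ TS)
    (hΔ : 0 < Δ) (hΩ : 0 < Ω₀) {j : Fin (L + 1)}
    (hE : ErrorBound ket (x 0) (x j) Δ Ω₀ TS δ) :
    ∃ β : ℝ, 0 ≤ β ∧ β ^ 2 ≤ Δ * (Ω₀ / Δ * (Ω₀ / Δ * Δ) * ‖x j‖ * ‖x 0‖) ∧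
      SmallOffBlocks (toOp (projS1 ket ⊗ₖ (1 : Matrix (Fin 2) (Fin 2) ℂ)))
        (toOp (TS ⊗ₖ sigmaX + δ)) Δ (Ω₀ / Δ) β := by
  have hr : 0 < Ω₀ / Δ := by positivity
  have hr8 := hE.ratio
  have ha := hC.coeff_le_one h j
  have hb := hC.coeff_le_one h 0
  have hab : ‖x j‖ * ‖x 0‖ ≤ 1 := mul_le_one₀ ha (norm_nonneg _) hb
  have hrΔ : Ω₀ / Δ * Δ = Ω₀ := div_mul_cancel₀ _ hΔ.ne'
  set A := projS1 ket ⊗ₖ (1 : Matrix (Fin 2) (Fin 2) ℂ) with hA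
  set B := projS2 ket ⊗ₖ (1 : Matrix (Fin 2) (Fin 2) ℂ) with hB
  set V := TS ⊗ₖ sigmaX + δ with hV
  have hAh : A.IsHermitian := isHermitian_kronecker isHermitian_projS1 Matrix.isHermitian_one
  have hVh : V.IsHermitian :=
    (isHermitian_kronecker hC.isHermitian isHermitian_sigmaX).add hE.isHermitian
  have hBh : B.IsHermitian := by
    refine isHermitian_kronecker ?_ Matrix.isHermitian_one
    exact Matrix.isHermitian_one.sub isHermitian_projS1
  have hBv : ∀ v, toOp B v = v - toOp A v := projS2_kronecker_apply
  have hidem : ∀ v, toOp A (toOp A v) = toOp A v := fun v => jointVec_ext fun s => by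
    rw [bathComponent_system, bathComponent_system, toOp_projS1_idem h]
  have hβ2 : ‖A * V * B‖ ^ 2 ≤ Δ * (Ω₀ / Δ * (Ω₀ / Δ * Δ) * ‖x j‖ * ‖x 0‖) := by
    have h1 := (div_lt_iff₀ (by positivity)).1 hE.block12
    rw [norm_mul (x 0) (x j)] at h1
    refine h1.le.trans_eq ?_
    field_simp
  have h21 : ‖B * V * A‖ = ‖A * V * B‖ := by
    rw [← Matrix.l2_opNorm_conjTranspose, Matrix.conjTranspose_mul, Matrix.conjTranspose_mul,
      hAh.eq, hVh.eq, hBh.eq, mul_assoc]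
  refine ⟨‖A * V * B‖, norm_nonneg _, hβ2,
    inner_toOp_of_isHermitian hAh, hidem,
    norm_le_of_symm_idem _ (inner_toOp_of_isHermitian hAh) hidem,
    inner_toOp_of_isHermitian hVh, fun v => ?_, fun v => ?_, fun v => ?_, fun v => ?_, ?_⟩
  · rw [compressed_interaction hC]
    refine (norm_add_le _ _).trans ?_
    have h1 := norm_rankOne_apply_le hΩ.le hC.normalized v
    have h2 := (norm_toOp_apply_le (A * δ * A) v).trans
      (mul_le_mul_of_nonneg_right (hE.norm_compressed_le hΔ) (norm_nonneg v))
    have h3 : Ω₀ / Δ * (Ω₀ / Δ * Δ) * ‖x j‖ * ‖x 0‖ ≤ Ω₀ := by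
      rw [hrΔ]
      calc Ω₀ / Δ * Ω₀ * ‖x j‖ * ‖x 0‖ = Ω₀ / Δ * (‖x j‖ * ‖x 0‖) * Ω₀ := by ring
        _ ≤ 1 * 1 * Ω₀ := by gcongr; linarith
        _ = Ω₀ := by ring
    have h4 := mul_le_mul_of_nonneg_right h3 (norm_nonneg v)
    rw [mul_assoc 2, hrΔ]
    linarith
  · rw [← hBv, ← toOp_mul_apply, ← toOp_mul_apply]
    exact norm_toOp_apply_le _ _
  · rw [← hBv, ← toOp_mul_apply, ← toOp_mul_apply, ← h21]
    exact norm_toOp_apply_le _ _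
  · rw [← hBv, ← hBv, ← toOp_mul_apply, ← toOp_mul_apply]
    refine (norm_toOp_apply_le _ _).trans ?_
    have h1 := (div_lt_iff₀ hΔ).1 hE.block22
    gcongr
    linarith
  · rw [hrΔ]
    refine le_of_sq_le_sq (hβ2.trans ?_) hΩ.le
    rw [hrΔ]
    calc Δ * (Ω₀ / Δ * Ω₀ * ‖x j‖ * ‖x 0‖) = Ω₀ ^ 2 * (‖x j‖ * ‖x 0‖) := by
          field_simp
      _ ≤ Ω₀ ^ 2 * 1 := by gcongr
      _ = Ω₀ ^ 2 := mul_one _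

theorem toOp_stepHamiltonian_apply (HS TS : SysOp n) (ωB : ℝ) (δ : JointOp n) (v : JointVec n) :
    toOp (stepHamiltonian HS TS ωB δ) v
      = toOp (HS ⊗ₖ (1 : Matrix (Fin 2) (Fin 2) ℂ)) v
        + (ωB : ℂ) • toOp ((1 : SysOp n) ⊗ₖ bathUp) v + toOp (TS ⊗ₖ sigmaX + δ) v := by
  rw [stepHamiltonian, add_assoc]
  simp only [toOp, map_add, map_smul]
  simp only [_root_.add_apply, _root_.smul_apply]

theorem toOp_evolution (τ : ℝ) (H : JointOp n) :
    toOp (evolution τ H) = NormedSpace.exp ((-Complex.I * (τ : ℂ)) • toOp H) := by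
  let : NormedAlgebra ℚ (JointOp n) := NormedAlgebra.restrictScalars ℚ ℂ _
  have h := NormedSpace.map_exp (Matrix.toEuclideanCLM (𝕜 := ℂ) (n := Qubits n × Fin 2))
    (continuous_of_linear_of_bound (𝕜 := ℂ) (map_add _) (map_smul _) (C := 1)
      (fun A => by rw [one_mul, ← Matrix.cstar_norm_def])) ((-Complex.I * (τ : ℂ)) • H)
  rw [toOp, evolution, h, map_smul]

end CoolingStep

/-! ### One cooling step: transfer of level `j`, stability of the levels below it. -/

section CoolingStep

variable {n L : ℕ} {HS TS : SysOp n} {ket : Fin (L + 1) → SysVec n} {ω : Fin (L + 1) → ℝ}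
  {x : Fin (L + 1) → ℂ} {Δ Ω₀ : ℝ} {δ : JointOp n}

theorem isHermitian_stepHamiltonian (hHS : HS.IsHermitian) (hTS : TS.IsHermitian)
    (hδ : δ.IsHermitian) (ωB : ℝ) : (stepHamiltonian HS TS ωB δ).IsHermitian := by
  refine Matrix.IsHermitian.add (Matrix.IsHermitian.add (Matrix.IsHermitian.add ?_ ?_) ?_) hδ
  · exact isHermitian_kronecker hHS Matrix.isHermitian_one
  · rw [Matrix.IsHermitian, Matrix.conjTranspose_smul,
      (isHermitian_kronecker Matrix.isHermitian_one isHermitian_bathUp).eq]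
    simp
  · exact isHermitian_kronecker hTS isHermitian_sigmaX

/-- The resonance `|j↓⟩ ↔ |0↑⟩` can be tuned so that the bath qubit takes up the excitation. -/
theorem exists_tuned_transfer (hB : IsResolvedBand HS ket ω Δ) (hC : IsCoupling ket x Ω₀ TS)
    (hΩ : 0 < Ω₀) (hr : Ω₀ / Δ ≤ 1 / 100) {j : Fin (L + 1)}
    (hE : ErrorBound ket (x 0) (x j) Δ Ω₀ TS δ) :
    ∃ s τ : ℝ, |s| ≤ 12 * Ω₀ ∧ 0 < τ ∧ τ ≤ Real.pi / (Ω₀ * ‖x j‖ * ‖x 0‖) ∧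
      ∃ c : ℂ, ‖c‖ = 1 ∧
        ‖toOp (evolution τ (stepHamiltonian HS TS (ω j + s) δ)) (withBath 0 (ket j))
          - c • withBath 1 (ket 0)‖ ≤ 144 * (Ω₀ / Δ) := by
  have hΔ := hB.gap_pos
  have hON := hB.orthonormal
  obtain ⟨β, hβ, hβ2, hW⟩ := hE.smallOffBlocks hON hC hΔ hΩ
  have hrΔ : Ω₀ / Δ * Δ = Ω₀ := div_mul_cancel₀ _ hΔ.ne'
  -- This is `H_S + ω j |↑⟩⟨↑|` measured from the energy `ω j`, so both `|j↓⟩` and `|0↑⟩` lie in its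
  -- kernel.
  let D : JointVec n →L[ℂ] JointVec n := toOp (HS ⊗ₖ (1 : Matrix (Fin 2) (Fin 2) ℂ))
    - (ω j : ℂ) • toOp ((1 : SysOp n) ⊗ₖ bathDown)
  have hDv : ∀ v, D v = toOp (HS ⊗ₖ (1 : Matrix (Fin 2) (Fin 2) ℂ)) v
      - (ω j : ℂ) • toOp ((1 : SysOp n) ⊗ₖ bathDown) v := fun _ => rfl
  have hHSsym := inner_toOp_of_isHermitian
    (isHermitian_kronecker hB.isHermitian (Matrix.isHermitian_one (n := Fin 2) (α := ℂ)))
  have hdown := inner_toOp_of_isHermitian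
    (isHermitian_kronecker (Matrix.isHermitian_one (n := Qubits n) (α := ℂ)) isHermitian_bathDown)
  have hup := inner_toOp_of_isHermitian
    (isHermitian_kronecker (Matrix.isHermitian_one (n := Qubits n) (α := ℂ)) isHermitian_bathUp)
  have hket0 : toOp HS (ket 0) = 0 := by rw [hB.apply_ket, hB.zero_level]; simp
  have hSdown : ∀ v, toOp (projS1 ket ⊗ₖ (1 : Matrix (Fin 2) (Fin 2) ℂ))
      (toOp ((1 : SysOp n) ⊗ₖ bathDown) v) = toOp ((1 : SysOp n) ⊗ₖ bathDown)
      (toOp (projS1 ket ⊗ₖ (1 : Matrix (Fin 2) (Fin 2) ℂ)) v) := fun v => jointVec_ext fun s => by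
    rw [bathComponent_system, bathComponent_down, bathComponent_down, bathComponent_system]
    split_ifs <;> simp
  have hSup : ∀ v, toOp (projS1 ket ⊗ₖ (1 : Matrix (Fin 2) (Fin 2) ℂ))
      (toOp ((1 : SysOp n) ⊗ₖ bathUp) v) = toOp ((1 : SysOp n) ⊗ₖ bathUp)
      (toOp (projS1 ket ⊗ₖ (1 : Matrix (Fin 2) (Fin 2) ℂ)) v) := fun v => jointVec_ext fun s => by
    rw [bathComponent_system, bathComponent_up, bathComponent_up, bathComponent_system]
    split_ifs <;> simp
  have hS : ∀ i s, toOp (projS1 ket ⊗ₖ (1 : Matrix (Fin 2) (Fin 2) ℂ)) (withBath s (ket i))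
      = withBath s (ket i) := fun i s => by
    rw [system_withBath, toOp_projS1_ket hON]
  have herr : ∀ i s, ‖toOp ((projS1 ket ⊗ₖ (1 : Matrix (Fin 2) (Fin 2) ℂ)) * δ *
      (projS1 ket ⊗ₖ (1 : Matrix (Fin 2) (Fin 2) ℂ))) (withBath s (ket i))‖
      ≤ Ω₀ / Δ * (Ω₀ / Δ * Δ) * ‖x j‖ * ‖x 0‖ := fun i s =>
    (norm_toOp_apply_le _ _).trans <| by
      rw [norm_withBath, hON.1, mul_one]
      exact hE.norm_compressed_le hΔ
  have hGket : ∀ i, ‖inner ℂ (stateG ket x) (ket i)‖ = ‖x i‖ := fun i => by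
    rw [norm_inner_symm, inner_ket_stateG hON]
  have hSW : ∀ i s, ‖toOp (projS1 ket ⊗ₖ (1 : Matrix (Fin 2) (Fin 2) ℂ))
      (toOp (TS ⊗ₖ sigmaX + δ) (withBath s (ket i)))‖
      ≤ Ω₀ / Δ * Δ * ‖x i‖ + Ω₀ / Δ * (Ω₀ / Δ * Δ) * ‖x j‖ * ‖x 0‖ := fun i s => by
    rw [← hS i s, compressed_interaction hC, rankOne_withBath]
    refine (norm_add_le _ _).trans (add_le_add (le_of_eq ?_) (herr i s))
    rw [norm_smul, norm_withBath, hC.normalized, norm_mul, hGket, hrΔ, Complex.norm_real,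
      Real.norm_eq_abs, abs_of_pos hΩ, mul_one]
  obtain ⟨e, u, τ, he, hu, hτ, hτ', hU⟩ := exists_resonant_transfer (D := D)
    (S := toOp (projS1 ket ⊗ₖ (1 : Matrix (Fin 2) (Fin 2) ℂ))) (W := toOp (TS ⊗ₖ sigmaX + δ))
    (n₀ := toOp ((1 : SysOp n) ⊗ₖ bathDown)) (n₁ := toOp ((1 : SysOp n) ⊗ₖ bathUp))
    (p := withBath 0 (ket j)) (q := withBath 1 (ket 0)) (r := Ω₀ / Δ) (a := ‖x j‖) (b := ‖x 0‖)
    hΔ (by positivity) hr hβ hβ2 (hC.coeff_ne j) (hC.coeff_le_one hON j) (hC.coeff_ne 0)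
    (hC.coeff_le_one hON 0) hW
    (fun v w => by
      simp only [hDv, inner_sub_left, inner_sub_right, inner_smul_left, inner_smul_right, hHSsym,
        hdown, Complex.conj_ofReal])
    (fun v => by
      rw [hDv, hDv, map_sub, map_smul, hSdown]
      congr 1
      rw [← toOp_mul_apply, ← toOp_mul_apply, ← Matrix.mul_kronecker_mul,
        ← Matrix.mul_kronecker_mul, hB.invariant.eq])
    hdown hSdown hup hSup norm_down_add_up_le
    (by simp [down_withBath]) (by simp [up_withBath]) (by simp [down_withBath])
    (by simp [up_withBath]) (hS _ _) (hS _ _) (by simp [hON.1]) (by simp [hON.1])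
    (by rw [inner_withBath_left]; simp)
    (by rw [hDv, system_withBath, down_withBath, hB.apply_ket]; simp)
    (by rw [hDv, system_withBath, down_withBath, hket0]; simp)
    (fun v hp hq => by
      rw [inner_withBath_left] at hp hq
      refine norm_le_of_bathComponent hΔ.le fun s => ?_
      rw [hDv, map_sub, map_smul, bathComponent_system, bathComponent_down]
      fin_cases s
      · simpa using hB.gap_le j _ hp
      · have h := hB.gap_le 0 _ hq
        rw [hB.zero_level] at h
        simpa using h)
    (hSW _ _) (hSW _ _)
    (by
      have h1 : inner ℂ (withBath 0 (ket j)) (toOp (TS ⊗ₖ sigmaX + δ) (withBath 1 (ket 0)))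
          = inner ℂ (withBath 0 (ket j)) (toOp (projS1 ket ⊗ₖ (1 : Matrix (Fin 2) (Fin 2) ℂ))
            (toOp (TS ⊗ₖ sigmaX + δ) (toOp (projS1 ket ⊗ₖ (1 : Matrix (Fin 2) (Fin 2) ℂ))
              (withBath 1 (ket 0))))) := by
        rw [← hW.symm_S, hS, hS]
      rw [h1, compressed_interaction hC, rankOne_withBath, inner_add_right, inner_smul_right,
        inner_withBath_left, sub_self, bathComponent_withBath, if_pos rfl, inner_ket_stateG hON]
      refine le_trans ?_ (norm_sub_le_norm_add _ _)
      have h2 := (norm_inner_le_norm (𝕜 := ℂ) (withBath 0 (ket j))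
        (toOp ((projS1 ket ⊗ₖ (1 : Matrix (Fin 2) (Fin 2) ℂ)) * δ *
          (projS1 ket ⊗ₖ (1 : Matrix (Fin 2) (Fin 2) ℂ))) (withBath 1 (ket 0))))
      rw [norm_withBath, hON.1, one_mul] at h2
      replace h2 := h2.trans (herr 0 1)
      rw [norm_mul, norm_mul, hGket, Complex.norm_real, Real.norm_eq_abs, abs_of_pos hΩ]
      rw [hrΔ] at h2 ⊢
      linarith)
  rw [hrΔ] at hτ'
  rw [mul_assoc, hrΔ] at he hu
  -- Only the relative shift of `↓` and `↑` is physical: it corrects the bath energy, while `e`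
  -- itself moves the common energy to `ω j + e`.
  refine ⟨e - u, τ, ?_, hτ, hτ', ?_⟩
  · exact (abs_sub _ _).trans (by linarith)
  obtain ⟨c, hc, hc'⟩ := hU (toOp (stepHamiltonian HS TS (ω j + (e - u)) δ)) (ω j + e) fun v => by
    have hone : v = toOp ((1 : SysOp n) ⊗ₖ bathDown) v + toOp ((1 : SysOp n) ⊗ₖ bathUp) v :=
      jointVec_ext fun s => by
        rw [map_add, bathComponent_down, bathComponent_up]
        fin_cases s <;> simp
    rw [toOp_stepHamiltonian_apply, hDv]
    generalize toOp (HS ⊗ₖ (1 : Matrix (Fin 2) (Fin 2) ℂ)) v = y₁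
    generalize toOp (TS ⊗ₖ sigmaX + δ) v = y₂
    rw [congrArg (fun y => ((ω j + e : ℝ) : ℂ) • y) hone]
    push_cast
    module
  exact ⟨c, hc, by rwa [toOp_evolution]⟩

/-- A level below the one that is cooled is left in place. -/
theorem lower_level_evolution (hB : IsResolvedBand HS ket ω Δ) (hC : IsCoupling ket x Ω₀ TS)
    (hΩ : 0 < Ω₀) (hr : Ω₀ / Δ ≤ 1 / 100) {i j : Fin (L + 1)} (hij : i < j)
    (hE : ErrorBound ket (x 0) (x j) Δ Ω₀ TS δ) {s τ : ℝ} (hs : |s| ≤ 12 * Ω₀) (hτ : 0 ≤ τ) :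
    ∃ c : ℂ, ‖c‖ = 1 ∧
        ‖toOp (evolution τ (stepHamiltonian HS TS (ω j + s) δ)) (withBath 0 (ket i))
          - c • withBath 0 (ket i)‖ ≤ 144 * (Ω₀ / Δ) := by
  have hΔ := hB.gap_pos
  have hON := hB.orthonormal
  obtain ⟨β, hβ, hβ2, hW⟩ := hE.smallOffBlocks hON hC hΔ hΩ
  have hrΔ : Ω₀ / Δ * Δ = Ω₀ := div_mul_cancel₀ _ hΔ.ne'
  let D : JointVec n →L[ℂ] JointVec n := toOp (HS ⊗ₖ (1 : Matrix (Fin 2) (Fin 2) ℂ))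
    - (ω i : ℂ) • 1 + (ω j : ℂ) • toOp ((1 : SysOp n) ⊗ₖ bathUp)
  have hDv : ∀ v, D v = toOp (HS ⊗ₖ (1 : Matrix (Fin 2) (Fin 2) ℂ)) v
      - (ω i : ℂ) • v + (ω j : ℂ) • toOp ((1 : SysOp n) ⊗ₖ bathUp) v := fun _ => rfl
  -- The detuning `s` of the bath energy is treated as part of the perturbation. It acts on `↑`
  -- only, so it does not enlarge `W` on `|i↓⟩`.
  let W : JointVec n →L[ℂ] JointVec n :=
    toOp (TS ⊗ₖ sigmaX + δ) + (s : ℂ) • toOp ((1 : SysOp n) ⊗ₖ bathUp)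
  have hWv : ∀ v, W v = toOp (TS ⊗ₖ sigmaX + δ) v
      + (s : ℂ) • toOp ((1 : SysOp n) ⊗ₖ bathUp) v := fun _ => rfl
  have hHSsym := inner_toOp_of_isHermitian
    (isHermitian_kronecker hB.isHermitian (Matrix.isHermitian_one (n := Fin 2) (α := ℂ)))
  have hup := inner_toOp_of_isHermitian
    (isHermitian_kronecker (Matrix.isHermitian_one (n := Qubits n) (α := ℂ)) isHermitian_bathUp)
  have hlevel := hB.level_gap hij
  have hS : toOp (projS1 ket ⊗ₖ (1 : Matrix (Fin 2) (Fin 2) ℂ)) (withBath 0 (ket i))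
      = withBath 0 (ket i) := by
    rw [system_withBath, toOp_projS1_ket hON]
  obtain ⟨c, hc, hc'⟩ := isolated_level_evolution
    (toOp (stepHamiltonian HS TS (ω j + s) δ)) D W (withBath 0 (ket i)) (s := 3 * Ω₀)
    (lam := ω i) hΔ
    (fun v w => by
      simp only [hDv, inner_sub_left, inner_sub_right, inner_add_left, inner_add_right,
        inner_smul_left, inner_smul_right, hHSsym, hup, Complex.conj_ofReal])
    (fun v w => by
      simp only [hWv, inner_add_left, inner_add_right,
        inner_smul_left, inner_smul_right, hW.symm_W, hup, Complex.conj_ofReal])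
    (by rw [norm_withBath, hON.1])
    (by rw [hDv, system_withBath, up_withBath, hB.apply_ket]; simp)
    (fun v hv => by
      rw [inner_withBath_left] at hv
      refine norm_le_of_bathComponent hΔ.le fun t => ?_
      rw [hDv, map_add, map_sub, map_smul, map_smul, bathComponent_system, bathComponent_up]
      fin_cases t
      · simpa using hB.gap_le i _ hv
      -- On the `↑` component `D` is `H_S + (ω j - ω i)`, which is at least `Δ` because `H_S ≥ 0`
      -- and `i < j`; for `i > j` this argument fails.
      · have h := hB.shift_le (hΔ.le.trans hlevel) (bathComponent 1 v)
        have h1 : toOp HS (bathComponent 1 v) - (ω i : ℂ) • bathComponent 1 v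
            + (ω j : ℂ) • bathComponent 1 v
            = toOp HS (bathComponent 1 v) + ((ω j - ω i : ℝ) : ℂ) • bathComponent 1 v := by
          push_cast; module
        have h2 := mul_le_mul_of_nonneg_right hlevel (norm_nonneg (bathComponent 1 v))
        rw [← h1] at h
        simpa using h2.trans h)
    (fun v => by
      have h1 := hW.norm_apply_le v
      have h2 := norm_down_add_up_le 0 s (12 * Ω₀) v (by simp; exact hΩ.le) hs
      rw [Complex.ofReal_zero, zero_smul, zero_add] at h2
      rw [hWv]
      refine (norm_add_le _ _).trans ?_
      have h3 : (1 / 2 + 4 * (Ω₀ / Δ)) * Δ + 12 * Ω₀ ≤ 3 / 4 * Δ := by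
        have h4 : Ω₀ ≤ 1 / 100 * Δ := (div_le_iff₀ hΔ).1 hr
        rw [add_mul, mul_assoc, hrΔ]
        linarith
      have h4 := mul_le_mul_of_nonneg_right h3 (norm_nonneg v)
      linarith)
    (by
      rw [hWv, up_withBath]
      have h1 := hW.norm_apply_le_of_mem hS
      rw [norm_withBath, hON.1, mul_one, mul_assoc, hrΔ] at h1
      simpa using h1)
    (by
      have h4 : Ω₀ ≤ 1 / 100 * Δ := (div_le_iff₀ hΔ).1 hr
      linarith)
    (fun v => by
      rw [toOp_stepHamiltonian_apply, hDv, hWv]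
      push_cast
      module) hτ
  refine ⟨c, hc, ?_⟩
  rw [toOp_evolution]
  refine hc'.trans ?_
  have : 0 ≤ Ω₀ / Δ := by positivity
  calc 16 * (3 * Ω₀) / Δ = 48 * (Ω₀ / Δ) := by ring
    _ ≤ _ := by linarith

end CoolingStep

/-! ### Propagation of errors through the sequence of measurements. -/

section Bookkeeping

variable {n : ℕ}

theorem sqrt_sq_add_sq_le {a b c d x y : ℝ}
    (hx : 0 ≤ x) (hy : 0 ≤ y) (hxab : x ≤ a + b) (hycd : y ≤ c + d) :
    √(x ^ 2 + y ^ 2) ≤ √(a ^ 2 + c ^ 2) + √(b ^ 2 + d ^ 2) := by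
  have h1 : a * b + c * d ≤ √(a ^ 2 + c ^ 2) * √(b ^ 2 + d ^ 2) := by
    rw [← Real.sqrt_mul (by positivity)]
    refine Real.le_sqrt_of_sq_le ?_
    nlinarith [sq_nonneg (a * d - b * c)]
  rw [Real.sqrt_le_iff]
  refine ⟨by positivity, ?_⟩
  rw [add_sq, Real.sq_sqrt (by positivity), Real.sq_sqrt (by positivity)]
  have h2 := pow_le_pow_left₀ hx hxab 2
  have h3 := pow_le_pow_left₀ hy hycd 2
  nlinarith

/-- Square root of the probability that the cooling protocol started in the pure state `v` ends
outside the kernel of the projector `A`. -/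
noncomputable def failureNorm (A : JointOp n) : {L : ℕ} → (Fin L → JointOp n) → JointVec n → ℝ
  | 0, _, v => ‖toOp A v‖
  | L + 1, U, v =>
    √(failureNorm A (fun k : Fin L => U k.castSucc)
        (toOp (U (Fin.last L)) (toOp ((1 : SysOp n) ⊗ₖ bathDown) v)) ^ 2
      + failureNorm A (fun k : Fin L => U k.castSucc) (toOp ((1 : SysOp n) ⊗ₖ bathUp) v) ^ 2)

theorem failureNorm_nonneg (A : JointOp n) {L : ℕ} (U : Fin L → JointOp n) (v : JointVec n) :
    0 ≤ failureNorm A U v := by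
  cases L with
  | zero => exact norm_nonneg _
  | succ L => exact Real.sqrt_nonneg _

/-- Each measurement branch is a linear image of the initial vector and the failure norm is the
Hilbert norm of the tuple of branches, so Minkowski's inequality applies. Errors of successive steps
therefore add as amplitudes. -/
theorem failureNorm_add_le (A : JointOp n) {L : ℕ} (U : Fin L → JointOp n) (v w : JointVec n) :
    failureNorm A U (v + w) ≤ failureNorm A U v + failureNorm A U w := by
  induction L generalizing v w with
  | zero =>
    simp only [failureNorm, map_add]
    exact norm_add_le _ _
  | succ L ih =>
    simp only [failureNorm]
    refine sqrt_sq_add_sq_le (failureNorm_nonneg _ _ _) (failureNorm_nonneg _ _ _) ?_ ?_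
    · rw [map_add, map_add]; exact ih _ _ _
    · rw [map_add]; exact ih _ _ _

theorem norm_sq_down_add_up (v : JointVec n) :
    ‖toOp ((1 : SysOp n) ⊗ₖ bathDown) v‖ ^ 2 + ‖toOp ((1 : SysOp n) ⊗ₖ bathUp) v‖ ^ 2
      = ‖v‖ ^ 2 := by
  simp [norm_sq_eq_sum_bathComponent, bathComponent_down, bathComponent_up]

theorem failureNorm_le (A : JointOp n) (hA : ∀ v, ‖toOp A v‖ ≤ ‖v‖) {L : ℕ}
    (U : Fin L → JointOp n) (hU : ∀ k v, ‖toOp (U k) v‖ = ‖v‖) (v : JointVec n) :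
    failureNorm A U v ≤ ‖v‖ := by
  induction L generalizing v with
  | zero => exact hA v
  | succ L ih =>
    simp only [failureNorm]
    refine Real.sqrt_le_iff.2 ⟨norm_nonneg _, ?_⟩
    rw [← norm_sq_down_add_up v]
    have h1 := ih (fun k : Fin L => U k.castSucc) (fun k => hU _)
      (toOp (U (Fin.last L)) (toOp ((1 : SysOp n) ⊗ₖ bathDown) v))
    rw [hU] at h1
    exact add_le_add (pow_le_pow_left₀ (failureNorm_nonneg _ _ _) h1 2)
      (pow_le_pow_left₀ (failureNorm_nonneg _ _ _) (ih _ (fun k => hU _) _) 2)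

theorem failureNorm_zero (A : JointOp n) {L : ℕ} (U : Fin L → JointOp n) :
    failureNorm A U 0 = 0 := by
  induction L with
  | zero => simp [failureNorm]
  | succ L ih => simp [failureNorm, ih]

/-- After the outcome `↑` no further unitary acts. -/
theorem failureNorm_up (A : JointOp n) {L : ℕ} (U : Fin L → JointOp n) (u : SysVec n)
    (hu : toOp A (withBath 1 u) = 0) : failureNorm A U (withBath 1 u) = 0 := by
  induction L with
  | zero => simp [failureNorm, hu]
  | succ L ih =>
    simp only [failureNorm, down_withBath, up_withBath]
    simp [failureNorm_zero, ih]

/-- If every cooling step moves its level to the ground state and keeps the lower levels, up to an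
error `η`, then the complete protocol fails with amplitude at most `L η` times the `ℓ¹` norm of the
initial amplitudes. -/
theorem failureNorm_span_le (A : JointOp n) (hA : ∀ v, ‖toOp A v‖ ≤ ‖v‖) {η : ℝ} {L : ℕ}
    (ket : Fin (L + 1) → SysVec n) (hA0 : ∀ s, toOp A (withBath s (ket 0)) = 0)
    (U : Fin L → JointOp n) (hU : ∀ k v, ‖toOp (U k) v‖ = ‖v‖)
    (hlow : ∀ (k : Fin L) (l : Fin (L + 1)), l < k.succ → ∃ c : ℂ, ‖c‖ = 1 ∧
      ‖toOp (U k) (withBath 0 (ket l)) - c • withBath 0 (ket l)‖ ≤ η)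
    (hcool : ∀ k : Fin L, ∃ c : ℂ, ‖c‖ = 1 ∧
      ‖toOp (U k) (withBath 0 (ket k.succ)) - c • withBath 1 (ket 0)‖ ≤ η)
    (f : Fin (L + 1) → ℂ) :
    failureNorm A U (∑ l, f l • withBath 0 (ket l)) ≤ L * η * ∑ l, ‖f l‖ := by
  induction L with
  | zero => simp [failureNorm, hA0]
  | succ L ih =>
    set v := ∑ l, f l • withBath 0 (ket l) with hv
    have hdown : toOp ((1 : SysOp n) ⊗ₖ bathDown) v = v := by
      simp [hv, map_sum, down_withBath]
    have hup : toOp ((1 : SysOp n) ⊗ₖ bathUp) v = 0 := by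
      simp [hv, map_sum, up_withBath]
    simp only [failureNorm, hdown, hup, failureNorm_zero]
    rw [zero_pow two_ne_zero, add_zero, Real.sqrt_sq (failureNorm_nonneg _ _ _)]
    -- The step with index `Fin.last L` acts first and cools the top level. It leaves three pieces:
    -- `w` on the lower levels, left to the induction hypothesis; `w'` in `|0↑⟩`, which never fails;
    -- and a remainder `err`.
    choose c hc hc' using fun l : Fin (L + 1) =>
      hlow (Fin.last L) l.castSucc (by
        rw [Fin.succ_last]; exact Fin.castSucc_lt_last l)
    obtain ⟨d, hd, hd'⟩ := hcool (Fin.last L)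
    rw [Fin.succ_last] at hd'
    set U' : Fin L → JointOp n := fun k => U k.castSucc with hU'
    set w := ∑ l : Fin (L + 1), (f l.castSucc * c l) • withBath 0 (ket l.castSucc) with hw
    set w' := withBath 1 ((f (Fin.last _) * d) • ket 0) with hw'
    set err := toOp (U (Fin.last L)) v - (w + w') with herr
    have herr_le : ‖err‖ ≤ η * ∑ l, ‖f l‖ := by
      have h1 : err = ∑ l : Fin (L + 1), f l.castSucc •
            (toOp (U (Fin.last L)) (withBath 0 (ket l.castSucc))
              - c l • withBath 0 (ket l.castSucc))
          + f (Fin.last _) • (toOp (U (Fin.last L)) (withBath 0 (ket (Fin.last _)))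
              - d • withBath 1 (ket 0)) := by
        rw [herr, hv, hw, hw', map_sum, Fin.sum_univ_castSucc]
        simp only [map_smul, smul_sub, Finset.sum_sub_distrib, smul_smul]
        abel
      rw [h1, Fin.sum_univ_castSucc (fun l => ‖f l‖), mul_add, Finset.mul_sum]
      refine (norm_add_le _ _).trans (add_le_add ((norm_sum_le _ _).trans
        (Finset.sum_le_sum fun l _ => ?_)) ?_)
      · rw [norm_smul, mul_comm]
        exact mul_le_mul_of_nonneg_right (hc' l) (norm_nonneg _)
      · rw [norm_smul, mul_comm]
        exact mul_le_mul_of_nonneg_right hd' (norm_nonneg _)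
    have h2 : failureNorm A U' w ≤ L * η * ∑ l : Fin (L + 1), ‖f l.castSucc‖ := by
      have h3 := ih (fun l => ket l.castSucc) hA0 U' (fun k => hU _)
        (fun k l hkl => hlow k.castSucc l.castSucc (by
          rw [← Fin.castSucc_succ]; exact Fin.castSucc_lt_castSucc_iff.2 hkl))
        (fun k => by
          have := hcool k.castSucc
          rwa [← Fin.castSucc_succ] at this)
        (fun l => f l.castSucc * c l)
      simpa only [norm_mul, hc, mul_one] using h3
    have h3 : failureNorm A U' w' = 0 := by
      refine failureNorm_up A U' _ ?_
      rw [map_smul, map_smul, hA0, smul_zero]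
    have h4 : failureNorm A U' err ≤ ‖err‖ := failureNorm_le A hA U' (fun k => hU _) err
    have h5 : toOp (U (Fin.last L)) v = (w + w') + err := by rw [herr]; abel
    have hη : 0 ≤ η := (norm_nonneg _).trans hd'
    have h6 : ∑ l : Fin (L + 1), ‖f l.castSucc‖ ≤ ∑ l, ‖f l‖ := by
      rw [Fin.sum_univ_castSucc (n := L + 1)]
      exact le_add_of_nonneg_right (norm_nonneg _)
    have h7 : (L : ℝ) * η * ∑ l : Fin (L + 1), ‖f l.castSucc‖ ≤ L * η * ∑ l, ‖f l‖ := by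
      gcongr
    rw [h5]
    have h8 := failureNorm_add_le A U' (w + w') err
    have h9 := failureNorm_add_le A U' w w'
    push_cast
    linarith

/-- The density matrix of a pure state. -/
noncomputable def pureState (v : JointVec n) : JointOp n :=
  Matrix.vecMulVec v.ofLp (star v.ofLp)

theorem mul_pureState_mul (B : JointOp n) (v : JointVec n) :
    B * pureState v * B.conjTranspose = pureState (toOp B v) := by
  rw [pureState, pureState, Matrix.mul_vecMulVec, Matrix.vecMulVec_mul, Matrix.ofLp_toEuclideanCLM,
    Matrix.star_mulVec]

theorem coolingStep_pureState (U : JointOp n) (v : JointVec n) :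
    coolingStep U (pureState v)
      = pureState (toOp U (toOp ((1 : SysOp n) ⊗ₖ bathDown) v))
        + pureState (toOp ((1 : SysOp n) ⊗ₖ bathUp) v) := by
  have hd : ((1 : SysOp n) ⊗ₖ bathDown).conjTranspose = (1 : SysOp n) ⊗ₖ bathDown :=
    (isHermitian_kronecker Matrix.isHermitian_one isHermitian_bathDown).eq
  have hu : ((1 : SysOp n) ⊗ₖ bathUp).conjTranspose = (1 : SysOp n) ⊗ₖ bathUp :=
    (isHermitian_kronecker Matrix.isHermitian_one isHermitian_bathUp).eq
  rw [coolingStep, ← mul_pureState_mul U, ← mul_pureState_mul _ v, ← mul_pureState_mul _ v, hd, hu]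
  simp only [mul_assoc]

theorem coolingMap_add {L : ℕ} (U : Fin L → JointOp n) (ρ σ : JointOp n) :
    coolingMap U (ρ + σ) = coolingMap U ρ + coolingMap U σ := by
  induction L generalizing ρ σ with
  | zero => rfl
  | succ L ih =>
    simp only [coolingMap]
    rw [← ih]
    congr 1
    simp only [coolingStep, mul_add, add_mul]
    abel

theorem trace_mul_pureState (A : JointOp n) (hA : A.IsHermitian) (hA' : A * A = A)
    (v : JointVec n) : (A * pureState v).trace = ((‖toOp A v‖ ^ 2 : ℝ) : ℂ) := by
  have h1 : (A * pureState v).trace = (A * pureState v * A.conjTranspose).trace := by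
    rw [hA.eq, Matrix.trace_mul_comm (A * pureState v) A, ← mul_assoc, hA']
  rw [h1, mul_pureState_mul, pureState, Matrix.trace_vecMulVec]
  have h2 := inner_self_eq_norm_sq_to_K (𝕜 := ℂ) (toOp A v)
  rw [EuclideanSpace.inner_eq_star_dotProduct] at h2
  rw [h2]
  simp

/-- A step turns a pure state into a sum of two unnormalised pure states, one per outcome, so
probabilities add over the branches exactly as in the recursion for `failureNorm`. -/
theorem trace_mul_coolingMap (A : JointOp n) (hA : A.IsHermitian) (hA' : A * A = A) {L : ℕ}
    (U : Fin L → JointOp n) (v : JointVec n) :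
    (A * coolingMap U (pureState v)).trace = ((failureNorm A U v ^ 2 : ℝ) : ℂ) := by
  induction L generalizing v with
  | zero => exact trace_mul_pureState A hA hA' v
  | succ L ih =>
    simp only [coolingMap, failureNorm]
    rw [coolingStep_pureState, coolingMap_add, mul_add, Matrix.trace_add, ih, ih,
      Real.sq_sqrt (by positivity), ← Complex.ofReal_add]

theorem trace_coolingMap {L : ℕ} (U : Fin L → JointOp n) (hU : ∀ k v, ‖toOp (U k) v‖ = ‖v‖)
    (v : JointVec n) : (coolingMap U (pureState v)).trace = ((‖v‖ ^ 2 : ℝ) : ℂ) := by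
  induction L generalizing v with
  | zero =>
    have h := trace_mul_pureState (1 : JointOp n) Matrix.isHermitian_one (mul_one _) v
    rw [one_mul] at h
    simpa [coolingMap, toOp] using h
  | succ L ih =>
    simp only [coolingMap]
    rw [coolingStep_pureState, coolingMap_add, Matrix.trace_add, ih _ (fun k => hU _),
      ih _ (fun k => hU _), hU, ← Complex.ofReal_add, norm_sq_down_add_up]

theorem ketbra_kronecker_bathDown (F : SysVec n) :
    ketbra F F ⊗ₖ bathDown = pureState (withBath 0 F) := by
  ext ⟨a, s⟩ ⟨b, t⟩
  simp only [Matrix.kroneckerMap_apply, ketbra, pureState, Matrix.vecMulVec_apply, Pi.star_apply,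
    withBath_apply]
  fin_cases s <;> fin_cases t <;> simp [bathDown]

end Bookkeeping

/-! ### Failure probability of the protocol and choice of constants. -/

section Final

theorem ketbra_mul_ketbra {n : ℕ} (u : SysVec n) (hu : ‖u‖ = 1) :
    ketbra u u * ketbra u u = ketbra u u := by
  apply (Matrix.toEuclideanCLM (𝕜 := ℂ) (n := Qubits n)).injective
  ext1 v
  refine (toOp_mul_apply _ _ _).trans ?_
  rw [toOp_ketbra_apply, toOp_ketbra_apply, inner_smul_right, inner_self_eq_norm_sq_to_K, hu]
  refine Eq.trans ?_ (toOp_ketbra_apply u u v).symm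
  simp

theorem norm_evolution_apply {n : ℕ} {H : JointOp n} (hH : H.IsHermitian) (τ : ℝ)
    (v : JointVec n) : ‖toOp (evolution τ H) v‖ = ‖v‖ := by
  rw [toOp_evolution]
  exact norm_exp_apply_eq _ (inner_toOp_of_isHermitian hH) τ v

/-- The probability that the cooling protocol misses the ground state. -/
theorem norm_one_sub_trace_coolingMap_le {n L : ℕ} {ket : Fin (L + 1) → SysVec n}
    (hON : Orthonormal ℂ ket) {η : ℝ}
    (U : Fin L → JointOp n) (hU : ∀ k v, ‖toOp (U k) v‖ = ‖v‖)
    (hlow : ∀ (k : Fin L) (l : Fin (L + 1)), l < k.succ → ∃ c : ℂ, ‖c‖ = 1 ∧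
      ‖toOp (U k) (withBath 0 (ket l)) - c • withBath 0 (ket l)‖ ≤ η)
    (hcool : ∀ k : Fin L, ∃ c : ℂ, ‖c‖ = 1 ∧
      ‖toOp (U k) (withBath 0 (ket k.succ)) - c • withBath 1 (ket 0)‖ ≤ η)
    {F : SysVec n} (hF : F ∈ Submodule.span ℂ (Set.range ket)) (hF1 : ‖F‖ = 1) :
    ‖1 - ((ketbra (ket 0) (ket 0) ⊗ₖ (1 : Matrix (Fin 2) (Fin 2) ℂ)) *
        coolingMap U (ketbra F F ⊗ₖ bathDown)).trace‖ ≤ L ^ 2 * η ^ 2 * (L + 1) := by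
  set P := ketbra (ket 0) (ket 0) ⊗ₖ (1 : Matrix (Fin 2) (Fin 2) ℂ) with hP
  have hPh : P.IsHermitian := isHermitian_kronecker (isHermitian_ketbra _) Matrix.isHermitian_one
  have hPP : P * P = P := by
    rw [hP, ← Matrix.mul_kronecker_mul, ketbra_mul_ketbra _ (hON.1 0), mul_one]
  have hAh : (1 - P).IsHermitian := Matrix.isHermitian_one.sub hPh
  have hAA : (1 - P) * (1 - P) = 1 - P := by
    rw [mul_sub, sub_mul, sub_mul, hPP]; simp
  have hA : ∀ v, ‖toOp (1 - P) v‖ ≤ ‖v‖ :=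
    norm_le_of_symm_idem _ (inner_toOp_of_isHermitian hAh) fun v => by
      rw [← toOp_mul_apply, hAA]
  have hA0 : ∀ s, toOp (1 - P) (withBath s (ket 0)) = 0 := fun s => by
    have h1 : toOp (1 - P) (withBath s (ket 0))
        = withBath s (ket 0) - toOp P (withBath s (ket 0)) := by
      simp only [toOp, map_sub, map_one]; rfl
    rw [h1, hP, system_withBath, toOp_ketbra_apply, inner_self_eq_norm_sq_to_K, hON.1]
    simp
  obtain ⟨f, rfl⟩ := (Submodule.mem_span_range_iff_exists_fun ℂ).1 hF
  have hf : ∑ l, ‖f l‖ ^ 2 = 1 := by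
    have h1 : inner ℂ (∑ l, f l • ket l) (∑ l, f l • ket l) = (1 : ℂ) := by
      rw [inner_self_eq_norm_sq_to_K, hF1]; simp
    rw [hON.inner_sum] at h1
    have h2 : ∀ l, (starRingEnd ℂ) (f l) * f l = ((‖f l‖ ^ 2 : ℝ) : ℂ) := fun l => by
      rw [mul_comm, Complex.mul_conj, Complex.normSq_eq_norm_sq]
    simp only [h2] at h1
    exact_mod_cast h1
  -- Cauchy–Schwarz: the `ℓ¹` norm of the amplitudes costs a factor `√(L+1)`.
  have hsum : (∑ l, ‖f l‖) ^ 2 ≤ L + 1 := by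
    have h1 := sq_sum_le_card_mul_sum_sq (s := Finset.univ) (f := fun l => ‖f l‖)
    rw [hf] at h1
    simpa using h1
  rw [ketbra_kronecker_bathDown]
  have htr := trace_coolingMap U hU (withBath 0 (∑ l, f l • ket l))
  rw [norm_withBath, hF1] at htr
  -- The map preserves the trace, so one minus the success probability is the weight on `1 - P`.
  have hfail := trace_mul_coolingMap (1 - P) hAh hAA U (withBath 0 (∑ l, f l • ket l))
  rw [sub_mul, one_mul, Matrix.trace_sub, htr] at hfail
  simp only [one_pow, Complex.ofReal_one] at hfail
  rw [hfail, Complex.norm_real, Real.norm_eq_abs, abs_of_nonneg (sq_nonneg _)]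
  have h1 := failureNorm_span_le (1 - P) hA ket hA0 U hU hlow hcool f
  have h2 : withBath 0 (∑ l, f l • ket l) = ∑ l, f l • withBath 0 (ket l) := by
    simp only [map_sum, map_smul]
  rw [h2]
  calc _ ≤ (L * η * ∑ l, ‖f l‖) ^ 2 := pow_le_pow_left₀ (failureNorm_nonneg _ _ _) h1 2
    _ = L ^ 2 * η ^ 2 * (∑ l, ‖f l‖) ^ 2 := by ring
    _ ≤ _ := by gcongr

end Final

theorem theorem3 :
    ∀ c : ℝ, 0 < c → ∃ C : ℝ, 0 < C ∧ ∃ ε₀ : ℝ, 0 < ε₀ ∧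
      ∀ (n L : ℕ), 1 ≤ L →
      ∀ (HS : SysOp n) (ket : Fin (L + 1) → SysVec n) (ω : Fin (L + 1) → ℝ) (Δ : ℝ),
        IsResolvedBand HS ket ω Δ →
      ∀ (ε : ℝ), 0 < ε → ε < ε₀ →
      ∀ (Ω₀ : ℝ), Ω₀ / Δ = c * ε * (L : ℝ) ^ (-(5 / 2) : ℝ) →
      ∀ (x : Fin (L + 1) → ℂ) (TS : SysOp n), IsCoupling ket x Ω₀ TS →
      ∀ (δ : Fin L → JointOp n),
        (∀ k : Fin L, ErrorBound ket (x 0) (x k.succ) Δ Ω₀ TS (δ k)) →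
      ∃ (ωB τ : Fin L → ℝ), (∀ k, 0 < τ k) ∧
        (∀ F : SysVec n, F ∈ Submodule.span ℂ (Set.range ket) → ‖F‖ = 1 →
          ‖1 - ((ketbra (ket 0) (ket 0) ⊗ₖ (1 : Matrix (Fin 2) (Fin 2) ℂ)) *
              coolingMap (fun k => evolution (τ k) (stepHamiltonian HS TS (ωB k) (δ k)))
                (ketbra F F ⊗ₖ bathDown)).trace‖ ≤ C * ε) ∧
        ∑ k, τ k ≤ C * ((L : ℝ) ^ (5 / 2 : ℝ) / (ε * Δ * ‖x 0‖)) * ∑ k : Fin L, 1 / ‖x k.succ‖ := by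
  intro c hc
  -- The first summand of `C` serves the error, the second the time. The threshold on `ε` gives `ε ^
  -- 2 ≤ ε` and `r ≤ 1 / 100`.
  refine ⟨2 * 144 ^ 2 * c ^ 2 + Real.pi / c, by positivity, min 1 (1 / (100 * c)), by positivity,
    ?_⟩
  intro n L hL HS ket ω Δ hB ε hε hεlt Ω₀ hΩΔ x TS hC δ hE
  have hΔ := hB.gap_pos
  have hL1 : (1 : ℝ) ≤ L := by exact_mod_cast hL
  have hL0 : (0 : ℝ) < L := by linarith
  set y : ℝ := (L : ℝ) ^ (-(5 / 2) : ℝ) with hy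
  have hy0 : 0 < y := Real.rpow_pos_of_pos hL0 _
  have hy1 : y ≤ 1 := Real.rpow_le_one_of_one_le_of_nonpos hL1 (by norm_num)
  have hyinv : (L : ℝ) ^ (5 / 2 : ℝ) = y⁻¹ := by
    rw [hy, Real.rpow_neg hL0.le, inv_inv]
  have hyL : y ^ 2 * L ^ 5 = 1 := by
    rw [hy, ← Real.rpow_natCast, ← Real.rpow_mul hL0.le, ← Real.rpow_natCast (L : ℝ) 5,
      ← Real.rpow_add hL0]
    norm_num
  have hr : 0 < Ω₀ / Δ := by rw [hΩΔ]; positivity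
  have hΩ : 0 < Ω₀ := (div_pos_iff_of_pos_right hΔ).1 hr
  have hε1 := (hεlt.trans_le (min_le_left _ _)).le
  have hcε : c * ε ≤ 1 / 100 := by
    have h1 := (hεlt.trans_le (min_le_right _ _)).le
    calc c * ε ≤ c * (1 / (100 * c)) := by gcongr
      _ = 1 / 100 := by field_simp
  have hr' : Ω₀ / Δ ≤ 1 / 100 := by
    rw [hΩΔ]
    calc c * ε * y ≤ 1 / 100 * 1 := by gcongr
      _ = 1 / 100 := mul_one _
  choose s τ hs hτ hτ' hcool using fun k : Fin L =>
    exists_tuned_transfer hB hC hΩ hr' (hE k)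
  refine ⟨fun k => ω k.succ + s k, τ, hτ, fun F hF hF1 => ?_, ?_⟩
  · have h1 := norm_one_sub_trace_coolingMap_le hB.orthonormal
      (η := 144 * (Ω₀ / Δ))
      (fun k => evolution (τ k) (stepHamiltonian HS TS (ω k.succ + s k) (δ k)))
      (fun k v => norm_evolution_apply
        (isHermitian_stepHamiltonian hB.isHermitian hC.isHermitian (hE k).isHermitian _) _ v)
      (fun k l hl => lower_level_evolution hB hC hΩ hr' hl (hE k) (hs k) (hτ k).le)
      hcool hF hF1
    refine h1.trans ?_
    rw [hΩΔ]
    -- The failure probability needs only `r ^ 2` of order `L ^ (-3)`, whereas `y ^ 2 = L ^ (-5)`,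
    -- so there is room to spare.
    have h2 : y ^ 2 * (L ^ 2 * (L + 1)) ≤ 2 := by
      calc y ^ 2 * ((L : ℝ) ^ 2 * (L + 1)) ≤ y ^ 2 * ((L : ℝ) ^ 2 * (2 * L ^ 3)) := by
            gcongr
            nlinarith [pow_le_pow_right₀ hL1 (show 1 ≤ 3 by norm_num)]
        _ = 2 * (y ^ 2 * L ^ 5) := by ring
        _ = 2 := by rw [hyL, mul_one]
    have hpi : 0 < Real.pi / c := by positivity
    calc (L : ℝ) ^ 2 * (144 * (c * ε * y)) ^ 2 * (L + 1)
        = 144 ^ 2 * c ^ 2 * (ε * ε) * (y ^ 2 * (L ^ 2 * (L + 1))) := by ring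
      _ ≤ 144 ^ 2 * c ^ 2 * (1 * ε) * 2 := by gcongr
      _ = 2 * 144 ^ 2 * c ^ 2 * ε := by ring
      _ ≤ _ := by gcongr; linarith
  · have hx0 := hC.coeff_ne 0
    have h1 : ∀ k, τ k ≤ Real.pi / c * ((L : ℝ) ^ (5 / 2 : ℝ) / (ε * Δ * ‖x 0‖))
        * (1 / ‖x k.succ‖) := fun k => by
      have hxk := hC.coeff_ne k.succ
      refine (hτ' k).trans_eq ?_
      have h2 : Ω₀ = c * ε * y * Δ := by rw [← hΩΔ, div_mul_cancel₀ _ hΔ.ne']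
      rw [hyinv, h2]
      field_simp
    calc ∑ k, τ k ≤ ∑ k : Fin L, Real.pi / c * ((L : ℝ) ^ (5 / 2 : ℝ) / (ε * Δ * ‖x 0‖))
          * (1 / ‖x k.succ‖) := Finset.sum_le_sum fun k _ => h1 k
      _ = Real.pi / c * ((L : ℝ) ^ (5 / 2 : ℝ) / (ε * Δ * ‖x 0‖))
          * ∑ k : Fin L, 1 / ‖x k.succ‖ := by rw [Finset.mul_sum]
      _ ≤ _ := by
        gcongr
        have : 0 < 2 * 144 ^ 2 * c ^ 2 := by positivity
        linarith
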